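/- **Theorem 4.1 (parabolic tempered Schwarz lemma).** Let $X$ be a complex manifold of dimension $n\ge 1$, let $\tau>0$, let $I\subseteq\mathbf R$ be an interval with more than one point, and let $(\omega_t)_{t\in I}$ be a smooth family of Hermitian metrics on $X$ (smooth up to the end points that belong to $I$) with $$\frac{\partial}{\partial t}\omega_t\ \ge\ -\mathrm{Ric}^{\tau}_{\omega_t}-\omega_t\qquad\text{on } I\times X .$$ Let $\omega_h$ be a Hermitian metric on $X$ and $\kappa_0>0$ a constant with $\mathrm{RBC}^{\tau}_{\omega_h}(\xi)\le-\kappa_0$ at every point and for every nonzero non-negative Hermitian tensor $\xi=\sum\xi^{\alpha\bar\beta}\partial_\alpha\otimes\partial_{\bar\beta}$. Then $\mathrm{tr}_{\omega_t}(\omega_h)$ is smooth on $I\times X$, and $$\Big(\frac{\partial}{\partial t}-\Delta_{\omega_t}\Big)\mathrm{tr}_{\omega_t}(\omega_h)\ \le\ -\frac{\kappa_0}{n}\,\mathrm{tr}_{\omega_t}(\omega_h)^2+\mathrm{tr}_{\omega_t}(\omega_h)\qquad\text{on } I\times X .$$ In particular, if $X$ is compact and $0\in I$, then $\sup_X\mathrm{tr}_{\omega_0}(\omega_h)$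 is finite and, for all $t\in I$ with $t\ge 0$, $$\sup_X\mathrm{tr}_{\omega_t}(\omega_h)\ \le\ \max\Big\{\sup_X\mathrm{tr}_{\omega_0}(\omega_h),\ \frac{n}{\kappa_0}\Big\}.$$ Here, in local holomorphic coordinates and with summation over repeated indices, a Hermitian metric $\omega=\sqrt{-1}\,g_{k\bar\ell}\,dz^k\wedge d\bar z^\ell$ has inverse $g^{k\bar\ell}$, $g^{k\bar\ell}g_{j\bar\ell}=\delta^k_j$. Its Chern torsion and Chern curvature are $$T_{ij}^k=g^{k\bar\ell}(\partial_ig_{j\bar\ell}-\partial_jg_{i\bar\ell}),\qquad R_{i\bar jk\bar\ell}=-\partial_i\partial_{\bar j}g_{k\bar\ell}+g^{p\bar q}\,\partial_ig_{k\bar q}\,\partial_{\bar j}g_{p\bar\ell}.$$ The tempered Ricci curvature is the $(1,1)$-form with components $$\mathrm{Ric}^{\tau}_{k\bar\ell}=g^{i\bar j}R_{i\bar jk\bar\ell}+\tfrac14\big(1-\tfrac1\tau\big)\,g^{p\bar q}g^{r\bar s}\,T_{pr}^i\,\overline{T_{qs}^j}\,g_{k\bar j}\,g_{i\bar\ell},$$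 and the tempered real bisectional curvature is $$\mathrm{RBC}^{\tau}_{\omega}(\xi)=\frac1{|\xi|_\omega^2}\Big(R_{\alpha\bar\beta\gamma\bar\delta}-\tfrac{1-\tau}4\,T_{\alpha\gamma}^\rho\,\overline{T_{\beta\delta}^\sigma}\,g_{\rho\bar\sigma}\Big)\xi^{\alpha\bar\beta}\xi^{\gamma\bar\delta},\qquad |\xi|_\omega^2=g_{\alpha\bar\gamma}\,\overline{g_{\beta\bar\delta}}\,\xi^{\alpha\bar\beta}\,\overline{\xi^{\gamma\bar\delta}} .$$ Moreover $\mathrm{tr}_{\omega}(\omega_h)=g^{k\bar\ell}h_{k\bar\ell}$ and $\Delta_{\omega}u=g^{i\bar j}\partial_i\partial_{\bar j}u$; inequalities of real $(1,1)$-forms mean that the difference is a non-negative Hermitian form, and time derivatives at end points of $I$ are one-sided. -/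

import Mathlib

open scoped Manifold ContDiff ComplexConjugate ComplexOrder

noncomputable section

namespace TemperedSchwarz

/-! ### Calculus in `ℂⁿ` -/

section Local

variable {n : ℕ}

/-- The Wirtinger derivative `∂f/∂zⁱ = ½ (∂f/∂xⁱ - √-1 ∂f/∂yⁱ)`. -/
def dz (i : Fin n) (f : (Fin n → ℂ) → ℂ) (z : Fin n → ℂ) : ℂ :=
  (1 / 2 : ℂ) * (fderiv ℝ f z (Pi.single i 1) - Complex.I * fderiv ℝ f z (Pi.single i Complex.I))

/-- The Wirtinger derivative `∂f/∂z̄ʲ = ½ (∂f/∂xʲ + √-1 ∂f/∂yʲ)`. -/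
def dzbar (j : Fin n) (f : (Fin n → ℂ) → ℂ) (z : Fin n → ℂ) : ℂ :=
  (1 / 2 : ℂ) * (fderiv ℝ f z (Pi.single j 1) + Complex.I * fderiv ℝ f z (Pi.single j Complex.I))

/-! ### The Chern connection of a Hermitian metric in holomorphic coordinates

`G z k l` is the component `g_{k l̄}(z)` of a Hermitian metric in the coordinate frame
`∂/∂z¹, …, ∂/∂zⁿ`. -/

/-- The inverse metric `g^{k l̄}`, normalised by `∑ₗ g^{k l̄} g_{j l̄} = δ_{kj}`. -/
def invMetric (G : Matrix (Fin n) (Fin n) ℂ) (k l : Fin n) : ℂ := G⁻¹ l k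

/-- The Christoffel symbols of the Chern connection, `∇_{∂_i} ∂_j = ∑ₖ Γ_{ij}^k ∂_k`, that is
`Γ_{ij}^k = ∑ₗ g^{k l̄} ∂_i g_{j l̄}` (while `∇_{∂̄_i} ∂_j = 0`). -/
def christoffel (G : (Fin n → ℂ) → Matrix (Fin n) (Fin n) ℂ) (z : Fin n → ℂ)
    (i j k : Fin n) : ℂ :=
  ∑ l, invMetric (G z) k l * dz i (fun w => G w j l) z

/-- The Chern torsion `T(∂_i, ∂_j) = ∇_{∂_i} ∂_j - ∇_{∂_j} ∂_i = ∑ₖ T_{ij}^k ∂_k`. -/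
def torsion (G : (Fin n → ℂ) → Matrix (Fin n) (Fin n) ℂ) (z : Fin n → ℂ)
    (i j k : Fin n) : ℂ :=
  christoffel G z i j k - christoffel G z j i k

/-- The Chern curvature `R_{i j̄ k l̄} = g(∇_{∂_i} ∇_{∂̄_j} ∂_k - ∇_{∂̄_j} ∇_{∂_i} ∂_k, ∂̄_l)`, that is
`R_{i j̄ k l̄} = - ∂_i ∂̄_j g_{k l̄} + ∑ g^{p q̄} ∂_i g_{k q̄} ∂̄_j g_{p l̄}`. -/
def curvature (G : (Fin n → ℂ) → Matrix (Fin n) (Fin n) ℂ) (z : Fin n → ℂ)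
    (i j k l : Fin n) : ℂ :=
  - dz i (dzbar j (fun w => G w k l)) z
    + ∑ p, ∑ q, invMetric (G z) p q * dz i (fun w => G w k q) z * dzbar j (fun w => G w p l) z

/-- The second Chern Ricci curvature `Ric^{(2)}_{k l̄} = ∑ g^{i j̄} R_{i j̄ k l̄}`. -/
def ricciTwo (G : (Fin n → ℂ) → Matrix (Fin n) (Fin n) ℂ) (z : Fin n → ℂ) :
    Matrix (Fin n) (Fin n) ℂ :=
  Matrix.of fun k l => ∑ i, ∑ j, invMetric (G z) i j * curvature G z i j k l

/-- The quadratic torsion term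
`Q°_{k l̄} = ∑ g^{p q̄} g^{r s̄} T_{pr}^i conj(T_{qs}^j) g_{k j̄} g_{i l̄}`. -/
def torsionSq (G : (Fin n → ℂ) → Matrix (Fin n) (Fin n) ℂ) (z : Fin n → ℂ) :
    Matrix (Fin n) (Fin n) ℂ :=
  Matrix.of fun k l => ∑ p, ∑ q, ∑ r, ∑ s, ∑ i, ∑ j,
    invMetric (G z) p q * invMetric (G z) r s * torsion G z p r i * conj (torsion G z q s j)
      * G z k j * G z i l

/-- The tempered Ricci curvature `Ric^τ = Ric^{(2)} + ¼ (1 - 1/τ) Q°`. -/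
def temperedRicci (τ : ℝ) (G : (Fin n → ℂ) → Matrix (Fin n) (Fin n) ℂ) (z : Fin n → ℂ) :
    Matrix (Fin n) (Fin n) ℂ :=
  ricciTwo G z + (((1 - 1 / τ) / 4 : ℝ) : ℂ) • torsionSq G z

/-- The squared norm `|ξ|² = ∑ g_{α γ̄} conj(g_{β δ̄}) ξ^{α β̄} conj(ξ^{γ δ̄})` of a tensor
`ξ = ∑ ξ^{α β̄} ∂_α ⊗ ∂̄_β`. The sum is real. -/
def tensorNormSq (G : Matrix (Fin n) (Fin n) ℂ) (ξ : Matrix (Fin n) (Fin n) ℂ) : ℝ :=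
  (∑ α, ∑ β, ∑ γ, ∑ δ, G α γ * conj (G β δ) * ξ α β * conj (ξ γ δ)).re

/-- The tempered real bisectional curvature
`RBC^τ(ξ) = |ξ|⁻² ∑ (R_{α β̄ γ δ̄} - ¼ (1 - τ) ∑ T_{αγ}^ρ conj(T_{βδ}^σ) g_{ρ σ̄}) ξ^{α β̄} ξ^{γ δ̄}`.
The sum is real for Hermitian `ξ`. -/
def temperedRBC (τ : ℝ) (G : (Fin n → ℂ) → Matrix (Fin n) (Fin n) ℂ) (z : Fin n → ℂ)
    (ξ : Matrix (Fin n) (Fin n) ℂ) : ℝ :=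
  (∑ α, ∑ β, ∑ γ, ∑ δ,
    (curvature G z α β γ δ - (((1 - τ) / 4 : ℝ) : ℂ) *
      ∑ ρ, ∑ σ, torsion G z α γ ρ * conj (torsion G z β δ σ) * G z ρ σ) * ξ α β * ξ γ δ).re
    / tensorNormSq (G z) ξ

end Local

/-! ### Hermitian metrics on a complex manifold -/

section Global

variable {n : ℕ} {X : Type*} [TopologicalSpace X] [ChartedSpace (Fin n → ℂ) X]

/-- The components `g_{k l̄}(z) = g(∂/∂zᵏ, ∂/∂zˡ)` in a holomorphic chart `φ`, at the point with
coordinates `z ∈ φ.target`, of a field of sesquilinear forms on the holomorphic tangent bundle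
`TX ≅ T^{1,0}X`. -/
def components
    (form : (x : X) → TangentSpace 𝓘(ℂ, Fin n → ℂ) x →ₗ[ℂ]
      TangentSpace 𝓘(ℂ, Fin n → ℂ) x →ₗ⋆[ℂ] ℂ)
    (φ : OpenPartialHomeomorph X (Fin n → ℂ)) (z : Fin n → ℂ) : Matrix (Fin n) (Fin n) ℂ :=
  Matrix.of fun k l => form (φ.symm z)
    (mfderiv 𝓘(ℂ, Fin n → ℂ) 𝓘(ℂ, Fin n → ℂ) φ.symm z (Pi.single k 1 : Fin n → ℂ))
    (mfderiv 𝓘(ℂ, Fin n → ℂ) 𝓘(ℂ, Fin n → ℂ) φ.symm z (Pi.single l 1 : Fin n → ℂ))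

variable (n X) in
/-- A smooth Hermitian metric on the complex manifold `X`: a positive definite Hermitian form on
each holomorphic tangent space whose components in holomorphic charts are smooth. -/
structure HermitianMetric where
  form : (x : X) → TangentSpace 𝓘(ℂ, Fin n → ℂ) x →ₗ[ℂ]
    TangentSpace 𝓘(ℂ, Fin n → ℂ) x →ₗ⋆[ℂ] ℂ
  hermitian : ∀ x v w, form x w v = conj (form x v w)
  posDef : ∀ x v, v ≠ 0 → 0 < (form x v v).re
  smooth : ∀ φ ∈ atlas (Fin n → ℂ) X, ∀ k l,
    ContDiffOn ℝ ∞ (fun z => components form φ z k l) φ.target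

/-- The components of a Hermitian metric in a chart. -/
def HermitianMetric.coeff (g : HermitianMetric n X) (φ : OpenPartialHomeomorph X (Fin n → ℂ)) :
    (Fin n → ℂ) → Matrix (Fin n) (Fin n) ℂ :=
  components g.form φ

/-- `(g_t)_{t ∈ I}` is a smooth family of Hermitian metrics: its components are smooth functions
of `(t, z)`, up to the end points of `I` that belong to `I`. Nothing is asked of `t ∉ I`. -/
def SmoothFamilyOn (I : Set ℝ) (g : ℝ → HermitianMetric n X) : Prop :=
  ∀ φ ∈ atlas (Fin n → ℂ) X, ∀ k l,
    ContDiffOn ℝ ∞ (fun p : ℝ × (Fin n → ℂ) => (g p.1).coeff φ p.2 k l) (I ×ˢ φ.target)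

/-! The objects below are tensors (or scalars), so their value at `x` may be computed in any
holomorphic chart around `x`; the preferred chart `chartAt _ x` is used. -/

/-- The trace `tr_g h = ∑ g^{k l̄} h_{k l̄}`, a real function on `X`. -/
def trace (g h : HermitianMetric n X) (x : X) : ℝ :=
  let φ := chartAt (Fin n → ℂ) x
  (∑ k, ∑ l, invMetric (g.coeff φ (φ x)) k l * h.coeff φ (φ x) k l).re

/-- The complex (Chern) Laplacian `Δ_g u = ∑ g^{i j̄} ∂_i ∂̄_j u` of a real function. -/
def laplacian (g : HermitianMetric n X) (u : X → ℝ) (x : X) : ℝ :=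
  let φ := chartAt (Fin n → ℂ) x
  (∑ i, ∑ j, invMetric (g.coeff φ (φ x)) i j *
    dz i (dzbar j (fun z => (u (φ.symm z) : ℂ))) (φ x)).re

/-- The bound `RBC^τ ≤ c` on `X`: at every point and for every nonzero non-negative Hermitian `ξ`. -/
def TemperedRBCLe (τ : ℝ) (h : HermitianMetric n X) (c : ℝ) : Prop :=
  ∀ x : X, ∀ ξ : Matrix (Fin n) (Fin n) ℂ, ξ.PosSemidef → ξ ≠ 0 →
    temperedRBC τ (h.coeff (chartAt (Fin n → ℂ) x)) (chartAt (Fin n → ℂ) x x) ξ ≤ c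

/-- The components of `∂ω_t/∂t` at `x`, the derivative being taken within the interval `I`
(one-sided at an end point). -/
def timeDeriv (I : Set ℝ) (g : ℝ → HermitianMetric n X) (t : ℝ) (x : X) :
    Matrix (Fin n) (Fin n) ℂ :=
  let φ := chartAt (Fin n → ℂ) x
  Matrix.of fun k l => derivWithin (fun s => (g s).coeff φ (φ x) k l) I t

/-- The inequality of real `(1,1)`-forms `∂ω_t/∂t ≥ - Ric^τ(ω_t) - ω_t` on `I × X`. -/
def IsTemperedSupersolution (τ : ℝ) (I : Set ℝ) (g : ℝ → HermitianMetric n X) : Prop :=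
  ∀ t ∈ I, ∀ x : X,
    let φ := chartAt (Fin n → ℂ) x
    (timeDeriv I g t x - (- temperedRicci τ ((g t).coeff φ) (φ x) - (g t).coeff φ (φ x))).PosSemidef

end Global

end TemperedSchwarz

end

/-! In a chart, put u = tr(G⁻¹H). The Chern-Lu computation (`dz_dzbar_trace_inv_mul`) gives Δu = A −
B + Q. Here A pairs the second Ricci curvature of g with h, B contracts the curvature of h twice
with g⁻¹, and Q ≥ 0 is the squared norm, taken with g⁻¹, g⁻¹ and h, of the difference of the two
Chern connections.

The metrics are not assumed Kähler, so Q has to pay for the torsion terms in the two tempered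
curvatures. Keeping only the part skew in the lower indices gives Q ≥ ¼|T_h − T_g|². The weighted
Young inequality |a − b|² ≥ (1 − τ)|a|² + (1 − 1/τ)|b|² then produces exactly the tempered
corrections (`quadForm_connection_ge`). The T_g term completes A to the pairing of Ric^τ with h,
which the evolution inequality controls. The T_h term completes B to the numerator of RBC^τ at ξ =
g⁻¹, which is at most −κ₀ tr((G⁻¹H)²) ≤ −κ₀u²/n by Cauchy-Schwarz (`curvature_trace_le`).

For compact X, the right-hand side is negative where u > n/κ₀, while at a maximum over [0, t] × X
reached at a positive time the left-hand side is non-negative. The strict sign makes the usual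
ε-perturbation unnecessary (`trace_le_max`). -/

noncomputable section

namespace TemperedSchwarz

open scoped Topology Kronecker MatrixOrder
open Filter Matrix

/-! ### Product rules for matrix functions, common to ∂ᵢ, ∂̄ⱼ and the one-sided time derivative. -/

section Derivation

variable {E : Type*} [NormedAddCommGroup E] [NormedSpace ℝ E] {n : ℕ}

/-- `D` behaves like a first order differential operator at the point `z` of `s`, acting on functions
that are differentiable at `z` within `s`. -/
structure IsDerivationWithin (D : (E → ℂ) → ℂ) (s : Set E) (z : E) : Prop where
  mem : z ∈ s
  map_add : ∀ f g : E → ℂ, DifferentiableWithinAt ℝ f s z → DifferentiableWithinAt ℝ g s z →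
    D (fun w => f w + g w) = D f + D g
  map_mul : ∀ f g : E → ℂ, DifferentiableWithinAt ℝ f s z → DifferentiableWithinAt ℝ g s z →
    D (fun w => f w * g w) = D f * g z + f z * D g
  map_const : ∀ c : ℂ, D (fun _ => c) = 0
  map_congr : ∀ f g : E → ℂ, f =ᶠ[𝓝[s] z] g → D f = D g

/-- The matrix obtained by applying an operator to all entries of a matrix valued function. -/
def entrywise (D : (E → ℂ) → ℂ) (F : E → Matrix (Fin n) (Fin n) ℂ) : Matrix (Fin n) (Fin n) ℂ :=
  Matrix.of fun k l => D fun w => F w k l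

/-- All entries of a matrix valued function are differentiable. -/
def EntryDiff (F : E → Matrix (Fin n) (Fin n) ℂ) (s : Set E) (z : E) : Prop :=
  ∀ k l, DifferentiableWithinAt ℝ (fun w => F w k l) s z

/-- All entries of a matrix valued function are of class `C^m`. -/
def EntryContDiff (m : WithTop ℕ∞) (F : E → Matrix (Fin n) (Fin n) ℂ) (s : Set E) (z : E) : Prop :=
  ∀ k l, ContDiffWithinAt ℝ m (fun w => F w k l) s z

variable {s : Set E} {z : E} {F K : E → Matrix (Fin n) (Fin n) ℂ} {m : WithTop ℕ∞}
  {D : (E → ℂ) → ℂ}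

theorem EntryContDiff.entryDiff (hF : EntryContDiff m F s z) (hm : m ≠ 0) : EntryDiff F s z :=
  fun k l => (hF k l).differentiableWithinAt hm

theorem EntryContDiff.mul (hF : EntryContDiff m F s z) (hK : EntryContDiff m K s z) :
    EntryContDiff m (fun w => F w * K w) s z := fun k l => by
  simp only [Matrix.mul_apply]
  exact ContDiffWithinAt.sum fun i _ => (hF k i).mul (hK i l)

theorem EntryContDiff.trace (hF : EntryContDiff m F s z) :
    ContDiffWithinAt ℝ m (fun w => (F w).trace) s z := by
  simp only [Matrix.trace, Matrix.diag_apply]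
  exact ContDiffWithinAt.sum fun i _ => hF i i

theorem EntryContDiff.det (hF : EntryContDiff m F s z) :
    ContDiffWithinAt ℝ m (fun w => (F w).det) s z := by
  simp only [Matrix.det_apply']
  exact ContDiffWithinAt.sum fun σ _ => contDiffWithinAt_const.mul
    (contDiffWithinAt_prod fun i _ => hF (σ i) i)

/-- Cramer's rule: each entry of the inverse is a determinant with one row replaced, divided by the
determinant. -/
theorem EntryContDiff.inv (hF : EntryContDiff m F s z) (hz : IsUnit (F z)) :
    EntryContDiff m (fun w => (F w)⁻¹) s z := fun k l => by
  have hdet : (F z).det ≠ 0 := ((Matrix.isUnit_iff_isUnit_det _).1 hz).ne_zero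
  have e : (fun w => (F w)⁻¹ k l) =
      fun w => (F w).det⁻¹ * ((F w).updateRow l (Pi.single k 1)).det := by
    funext w
    rw [Matrix.inv_def, Matrix.smul_apply, Matrix.adjugate_apply, Ring.inverse_eq_inv', smul_eq_mul]
  rw [e]
  refine (hF.det.inv hdet).mul (EntryContDiff.det fun i j => ?_)
  by_cases hi : i = l
  · subst hi
    simpa using contDiffWithinAt_const
  · simpa [Matrix.updateRow_ne hi] using hF i j

theorem EntryDiff.mul (hF : EntryDiff F s z) (hK : EntryDiff K s z) :
    EntryDiff (fun w => F w * K w) s z := fun k l => by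
  simp only [Matrix.mul_apply]
  exact DifferentiableWithinAt.fun_sum fun i _ => (hF k i).mul (hK i l)

theorem EntryDiff.neg (hF : EntryDiff F s z) : EntryDiff (fun w => -F w) s z := fun k l => by
  simpa only [Matrix.neg_apply] using (hF k l).fun_neg

theorem EntryDiff.add (hF : EntryDiff F s z) (hK : EntryDiff K s z) :
    EntryDiff (fun w => F w + K w) s z := fun k l => by
  simpa only [Matrix.add_apply] using (hF k l).fun_add (hK k l)

namespace IsDerivationWithin

theorem map_neg (hD : IsDerivationWithin D s z) {f : E → ℂ} (hf : DifferentiableWithinAt ℝ f s z) :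
    D (fun w => -f w) = -D f := by
  have h := hD.map_mul (fun _ => -1) f (differentiableWithinAt_const _) hf
  simpa [hD.map_const] using h

theorem map_sum (hD : IsDerivationWithin D s z) {ι : Type*} (t : Finset ι) {f : ι → E → ℂ}
    (hf : ∀ i ∈ t, DifferentiableWithinAt ℝ (f i) s z) :
    D (fun w => ∑ i ∈ t, f i w) = ∑ i ∈ t, D (f i) := by
  classical
  induction t using Finset.induction_on with
  | empty => simpa using hD.map_const 0
  | insert a t ha ih =>
    simp only [Finset.sum_insert ha]
    rw [hD.map_add _ _ (hf _ (Finset.mem_insert_self _ _))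
      (DifferentiableWithinAt.fun_sum fun i hi => hf i (Finset.mem_insert_of_mem hi)),
      ih fun i hi => hf i (Finset.mem_insert_of_mem hi)]

theorem trace (hD : IsDerivationWithin D s z) (hF : EntryDiff F s z) :
    D (fun w => (F w).trace) = (entrywise D F).trace := by
  simp only [Matrix.trace, Matrix.diag_apply, entrywise, Matrix.of_apply]
  exact hD.map_sum _ fun i _ => hF i i

theorem entrywise_mul (hD : IsDerivationWithin D s z) (hF : EntryDiff F s z)
    (hK : EntryDiff K s z) :
    entrywise D (fun w => F w * K w) = entrywise D F * K z + F z * entrywise D K := by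
  ext k l
  simp only [entrywise, Matrix.of_apply, Matrix.mul_apply, Matrix.add_apply]
  rw [hD.map_sum _ fun i _ => (hF k i).fun_mul (hK i l), ← Finset.sum_add_distrib]
  exact Finset.sum_congr rfl fun i _ => hD.map_mul _ _ (hF k i) (hK i l)

theorem entrywise_add (hD : IsDerivationWithin D s z) (hF : EntryDiff F s z)
    (hK : EntryDiff K s z) :
    entrywise D (fun w => F w + K w) = entrywise D F + entrywise D K := by
  ext k l
  exact hD.map_add _ _ (hF k l) (hK k l)

theorem entrywise_neg (hD : IsDerivationWithin D s z) (hF : EntryDiff F s z) :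
    entrywise D (fun w => -F w) = -entrywise D F := by
  ext k l
  exact hD.map_neg (hF k l)

theorem entrywise_const (hD : IsDerivationWithin D s z) (A : Matrix (Fin n) (Fin n) ℂ) :
    entrywise D (fun _ => A) = 0 := by
  ext k l
  exact hD.map_const _

theorem entrywise_congr (hD : IsDerivationWithin D s z) (h : F =ᶠ[𝓝[s] z] K) :
    entrywise D F = entrywise D K := by
  ext k l
  exact hD.map_congr _ _ (h.mono fun w hw => by simp only [hw])

/-- Differentiate F⁻¹F = 1. This identity is needed near the point, not only at it, hence the
eventual invertibility. -/
theorem entrywise_inv (hD : IsDerivationWithin D s z) (hF : EntryContDiff m F s z) (hm : m ≠ 0)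
    (hu : ∀ᶠ w in 𝓝[s] z, IsUnit (F w)) :
    entrywise D (fun w => (F w)⁻¹) = -((F z)⁻¹ * entrywise D F * (F z)⁻¹) := by
  have hz : IsUnit (F z) := hu.self_of_nhdsWithin hD.mem
  have hdet := (Matrix.isUnit_iff_isUnit_det _).1 hz
  have h := hD.entrywise_mul ((hF.inv hz).entryDiff hm) (hF.entryDiff hm)
  rw [hD.entrywise_congr (K := fun _ => 1) (hu.mono fun w hw =>
    Matrix.nonsing_inv_mul _ ((Matrix.isUnit_iff_isUnit_det _).1 hw)), hD.entrywise_const] at h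
  have h2 := congrArg (· * (F z)⁻¹) (eq_neg_of_add_eq_zero_left h.symm)
  simpa [Matrix.mul_assoc, Matrix.mul_nonsing_inv _ hdet] using h2

/-- The first derivative of `tr (G⁻¹ H)`. -/
theorem trace_inv_mul (hD : IsDerivationWithin D s z) (hF : EntryContDiff m F s z)
    (hK : EntryContDiff m K s z) (hm : m ≠ 0) (hu : ∀ᶠ w in 𝓝[s] z, IsUnit (F w)) :
    D (fun w => ((F w)⁻¹ * K w).trace) =
      (-((F z)⁻¹ * entrywise D F * (F z)⁻¹) * K z + (F z)⁻¹ * entrywise D K).trace := by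
  have hz : IsUnit (F z) := hu.self_of_nhdsWithin hD.mem
  have hi := (hF.inv hz).entryDiff hm
  have hk := hK.entryDiff hm
  rw [hD.trace (hi.mul hk), hD.entrywise_mul hi hk, hD.entrywise_inv hF hm hu]

end IsDerivationWithin

end Derivation

/-! ### Wirtinger derivatives as derivations. -/

section Wirtinger

variable {n : ℕ} {z : Fin n → ℂ}

/-- Covers both Wirtinger operators at once: c = −i gives ∂ᵢ and c = i gives ∂̄ᵢ. -/
theorem isDerivationWithin_of_fderiv {E : Type*} [NormedAddCommGroup E] [NormedSpace ℝ E]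
    (z v w : E) (c : ℂ) : IsDerivationWithin
      (fun f : E → ℂ => (1 / 2 : ℂ) * (fderiv ℝ f z v + c * fderiv ℝ f z w)) Set.univ z where
  mem := Set.mem_univ _
  map_add f g hf hg := by
    rw [differentiableWithinAt_univ] at hf hg
    rw [fderiv_fun_add hf hg]
    simp only [_root_.add_apply]
    ring
  map_mul f g hf hg := by
    rw [differentiableWithinAt_univ] at hf hg
    rw [fderiv_fun_mul hf hg]
    simp only [_root_.add_apply, _root_.smul_apply, smul_eq_mul]
    ring
  map_const c := by simp
  map_congr f g h := by
    rw [nhdsWithin_univ] at h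
    rw [h.fderiv_eq]

theorem isDerivationWithin_dz (i : Fin n) (z : Fin n → ℂ) :
    IsDerivationWithin (fun f => dz i f z) Set.univ z := by
  convert isDerivationWithin_of_fderiv z (Pi.single i 1) (Pi.single i Complex.I) (-Complex.I) using 2
  rw [dz]; ring

theorem isDerivationWithin_dzbar (i : Fin n) (z : Fin n → ℂ) :
    IsDerivationWithin (fun f => dzbar i f z) Set.univ z :=
  isDerivationWithin_of_fderiv z (Pi.single i 1) (Pi.single i Complex.I) Complex.I

theorem isDerivationWithin_derivWithin {s : Set ℝ} {t : ℝ} (ht : t ∈ s) :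
    IsDerivationWithin (fun f : ℝ → ℂ => derivWithin f s t) s t where
  mem := ht
  map_add f g hf hg := derivWithin_fun_add hf hg
  map_mul f g hf hg := derivWithin_fun_mul hf hg
  map_const c := by simp
  map_congr f g h := h.derivWithin_eq (h.self_of_nhdsWithin ht)

theorem contDiffAt_dzbar {f : (Fin n → ℂ) → ℂ} {m k : WithTop ℕ∞} (hf : ContDiffAt ℝ m f z)
    (hk : k + 1 ≤ m) (j : Fin n) : ContDiffAt ℝ k (fun w => dzbar j f w) z := by
  have h := hf.fderiv_right hk
  exact contDiffAt_const.mul ((h.clm_apply contDiffAt_const).add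
    (contDiffAt_const.mul (h.clm_apply contDiffAt_const)))

theorem fderiv_conj {E : Type*} [NormedAddCommGroup E] [NormedSpace ℝ E] (f : E → ℂ) (z v : E) :
    fderiv ℝ (fun w => conj (f w)) z v = conj (fderiv ℝ f z v) := by
  have := (Complex.conjCLE : ℂ ≃L[ℝ] ℂ).comp_fderiv (f := f) (x := z)
  have h2 := congrArg (fun L => L v) this
  simpa [Function.comp_def] using h2

theorem dzbar_eq_conj_dz (j : Fin n) (f : (Fin n → ℂ) → ℂ) :
    dzbar j (fun w => conj (f w)) z = conj (dz j f z) := by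
  simp only [dz, dzbar, fderiv_conj, map_mul, map_sub, Complex.conj_I, map_div₀, map_one, map_ofNat]
  ring

/-- For a Hermitian matrix valued function, `∂̄ⱼ G` is the adjoint of `∂ⱼ G`. -/
theorem entrywise_dzbar_eq_conjTranspose {G : (Fin n → ℂ) → Matrix (Fin n) (Fin n) ℂ}
    (hG : ∀ᶠ w in 𝓝 z, (G w).IsHermitian) (j : Fin n) :
    entrywise (fun f => dzbar j f z) G = (entrywise (fun f => dz j f z) G)ᴴ := by
  ext k l
  simp only [entrywise, Matrix.of_apply, Matrix.conjTranspose_apply]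
  rw [← starRingEnd_apply, ← dzbar_eq_conj_dz]
  refine (isDerivationWithin_dzbar j z).map_congr _ _ ?_
  rw [nhdsWithin_univ]
  exact hG.mono fun w hw => (hw.apply k l).symm

end Wirtinger

/-! ### The Chern-Lu identity in matrix form. -/

section ChernLu

variable {n : ℕ}

/-- Completing the square. In the application g = G⁻¹, h = H, h' = H⁻¹, and A, B, C are ∂ᵢG, ∂̄ⱼG,
∂ᵢ∂̄ⱼG, with primes for H. The factor A'h' − Ag is the difference of the connection matrices in
direction i, and h'B' − gB is the adjoint of the one in direction j. Besides h'h = hh' = 1, only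
cyclicity of the trace enters. -/
theorem trace_chernLu_algebra {g h h' A B C A' B' C' : Matrix (Fin n) (Fin n) ℂ}
    (h1 : h' * h = 1) (h2 : h * h' = 1) :
    (-((-(g * A * g) * B + g * C) * g + g * B * -(g * A * g)) * h + -(g * B * g) * A' +
        (-(g * A * g) * B' + g * C')).trace =
      (g * (-C + A * g * B) * g * h).trace - (g * (-C' + A' * h' * B')).trace +
        (g * ((A' * h' - A * g) * h * (h' * B' - g * B))).trace := by
  have e : (A' * h' - A * g) * h * (h' * B' - g * B) =
      A' * h' * B' - A' * g * B - A * g * B' + A * g * h * g * B := by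
    have e1 : (A' * h' - A * g) * h = A' - A * g * h := by
      rw [sub_mul, Matrix.mul_assoc A', h1, Matrix.mul_one]
    have e2 : A * g * h * (h' * B') = A * g * B' := by
      rw [Matrix.mul_assoc (A * g), ← Matrix.mul_assoc h, h2, Matrix.one_mul]
    rw [e1, sub_mul, mul_sub, mul_sub, e2]
    simp only [← Matrix.mul_assoc]
    abel
  have t1 := Matrix.trace_mul_comm (g * B) (g * A * g * h)
  have t2 := Matrix.trace_mul_comm (g * B) (g * A')
  rw [e]
  simp only [mul_add, add_mul, mul_sub, neg_mul, mul_neg, Matrix.trace_add, Matrix.trace_sub,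
    Matrix.trace_neg, ← Matrix.mul_assoc, neg_add, neg_neg] at t1 t2 ⊢
  linear_combination t1 - t2

variable {G H : (Fin n → ℂ) → Matrix (Fin n) (Fin n) ℂ} {z : Fin n → ℂ}

/-- The matrix `(R_{i j̄ k l̄})_{k l}`. -/
def curvatureMatrix (G : (Fin n → ℂ) → Matrix (Fin n) (Fin n) ℂ) (z : Fin n → ℂ) (i j : Fin n) :
    Matrix (Fin n) (Fin n) ℂ :=
  Matrix.of fun k l => curvature G z i j k l

/-- The connection matrix `(Γ_{ik}^p)_{k p}`. -/
def connectionMatrix (G : (Fin n → ℂ) → Matrix (Fin n) (Fin n) ℂ) (z : Fin n → ℂ) (i : Fin n) :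
    Matrix (Fin n) (Fin n) ℂ :=
  Matrix.of fun k p => christoffel G z i k p

theorem connectionMatrix_eq (i : Fin n) :
    connectionMatrix G z i = entrywise (fun f => dz i f z) G * (G z)⁻¹ := by
  ext k p
  simp only [connectionMatrix, christoffel, entrywise, invMetric, Matrix.of_apply, Matrix.mul_apply]
  exact Finset.sum_congr rfl fun _ _ => mul_comm _ _

theorem curvatureMatrix_eq (i j : Fin n) :
    curvatureMatrix G z i j =
      -entrywise (fun f => dz i f z) (fun w => entrywise (fun f => dzbar j f w) G) +
        entrywise (fun f => dz i f z) G * (G z)⁻¹ * entrywise (fun f => dzbar j f z) G := by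
  ext k l
  simp only [curvatureMatrix, curvature, entrywise, invMetric, Matrix.of_apply, Matrix.mul_apply,
    Matrix.add_apply, Matrix.neg_apply, Finset.sum_mul]
  congr 1
  exact Finset.sum_congr rfl fun p _ => Finset.sum_congr rfl fun q _ => by ring

theorem EntryContDiff.eventually_of_univ {m : WithTop ℕ∞} (hG : EntryContDiff m G Set.univ z)
    (hm : m ≠ ∞) : ∀ᶠ w in 𝓝 z, EntryContDiff m G Set.univ w := by
  simp only [EntryContDiff, contDiffWithinAt_univ] at hG ⊢
  exact eventually_all.2 fun k => eventually_all.2 fun l => (hG k l).eventually hm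

theorem EntryContDiff.entrywise_dzbar {m k : WithTop ℕ∞} (hG : EntryContDiff m G Set.univ z)
    (hk : k + 1 ≤ m) (j : Fin n) :
    EntryContDiff k (fun w => entrywise (fun f => dzbar j f w) G) Set.univ z := fun a b => by
  have := hG a b
  rw [contDiffWithinAt_univ] at this ⊢
  exact contDiffAt_dzbar this hk j

/-- The Chern-Lu identity for the mixed second derivatives of `tr_g h`. -/
theorem dz_dzbar_trace_inv_mul (hG : EntryContDiff 2 G Set.univ z)
    (hH : EntryContDiff 2 H Set.univ z) (hGp : ∀ᶠ w in 𝓝 z, (G w).PosDef)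
    (hHp : ∀ᶠ w in 𝓝 z, (H w).PosDef) (i j : Fin n) :
    dz i (dzbar j fun w => ((G w)⁻¹ * H w).trace) z =
      ((G z)⁻¹ * curvatureMatrix G z i j * (G z)⁻¹ * H z).trace
        - ((G z)⁻¹ * curvatureMatrix H z i j).trace
        + ((G z)⁻¹ * ((connectionMatrix H z i - connectionMatrix G z i) * H z *
          (connectionMatrix H z j - connectionMatrix G z j)ᴴ)).trace := by
  have hu : ∀ᶠ w in 𝓝 z, IsUnit (G w) := hGp.mono fun w hw => hw.isUnit
  have hz := hu.self_of_nhds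
  have hHz := (Matrix.isUnit_iff_isUnit_det _).1 hHp.self_of_nhds.isUnit
  have two : (2 : WithTop ℕ∞) ≠ 0 := two_ne_zero
  have one : (1 : WithTop ℕ∞) ≠ 0 := one_ne_zero
  have h12 : (1 : WithTop ℕ∞) + 1 ≤ 2 := by norm_num
  -- The formula for ∂̄ⱼ must hold on a neighbourhood, because ∂ᵢ is applied to it next.
  have first : (dzbar j fun w => ((G w)⁻¹ * H w).trace) =ᶠ[𝓝 z] fun w =>
      (-((G w)⁻¹ * entrywise (fun f => dzbar j f w) G * (G w)⁻¹) * H w +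
        (G w)⁻¹ * entrywise (fun f => dzbar j f w) H).trace := by
    filter_upwards [hG.eventually_of_univ (by simp), hH.eventually_of_univ (by simp),
      hu.eventually_nhds] with w hGw hHw huw
    exact (isDerivationWithin_dzbar j w).trace_inv_mul hGw hHw two (by rwa [nhdsWithin_univ])
  have hD := isDerivationWithin_dz i z
  have hi := (hG.inv hz).entryDiff two
  have hB := (hG.entrywise_dzbar h12 j).entryDiff one
  have hB' := (hH.entrywise_dzbar h12 j).entryDiff one
  have hH1 := hH.entryDiff two
  refine ((hD.map_congr _ _ (by rwa [nhdsWithin_univ])).trans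
    (hD.trace ((((hi.mul hB).mul hi).neg.mul hH1).add (hi.mul hB')))).trans ?_
  rw [hD.entrywise_add (((hi.mul hB).mul hi).neg.mul hH1) (hi.mul hB'),
    hD.entrywise_mul ((hi.mul hB).mul hi).neg hH1, hD.entrywise_neg ((hi.mul hB).mul hi),
    hD.entrywise_mul (hi.mul hB) hi, hD.entrywise_mul hi hB, hD.entrywise_mul hi hB',
    hD.entrywise_inv hG two (by rwa [nhdsWithin_univ]), curvatureMatrix_eq, curvatureMatrix_eq,
    connectionMatrix_eq, connectionMatrix_eq, connectionMatrix_eq, connectionMatrix_eq,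
    Matrix.conjTranspose_sub, Matrix.conjTranspose_mul, Matrix.conjTranspose_mul,
    ← entrywise_dzbar_eq_conjTranspose (hGp.mono fun w hw => hw.isHermitian),
    ← entrywise_dzbar_eq_conjTranspose (hHp.mono fun w hw => hw.isHermitian),
    hGp.self_of_nhds.isHermitian.inv.eq, hHp.self_of_nhds.isHermitian.inv.eq]
  exact trace_chernLu_algebra (Matrix.nonsing_inv_mul _ hHz) (Matrix.mul_nonsing_inv _ hHz)

end ChernLu

/-! ### Two inequalities for positive semidefinite forms: weighted Young, and projection to the skew
part. -/

section QuadraticForm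

variable {ι : Type*} [Fintype ι]

/-- The real quadratic form `v ↦ Re (v* K v)`. -/
def quadForm (K : Matrix ι ι ℂ) (v : ι → ℂ) : ℝ := (star v ⬝ᵥ (K *ᵥ v)).re

theorem quadForm_nonneg {K : Matrix ι ι ℂ} (hK : K.PosSemidef) (v : ι → ℂ) : 0 ≤ quadForm K v :=
  (Complex.le_def.1 (hK.dotProduct_mulVec_nonneg v)).1

theorem quadForm_smul_sub (K : Matrix ι ι ℂ) (τ : ℝ) (a b : ι → ℂ) :
    quadForm K ((τ : ℂ) • a - b) = τ ^ 2 * quadForm K a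
      - τ * (star a ⬝ᵥ (K *ᵥ b) + star b ⬝ᵥ (K *ᵥ a)).re + quadForm K b := by
  simp only [quadForm, star_sub, star_smul, Matrix.mulVec_sub, Matrix.mulVec_smul,
    sub_dotProduct, dotProduct_sub, smul_dotProduct, dotProduct_smul, smul_eq_mul,
    Complex.star_def, Complex.conj_ofReal, Complex.sub_re, Complex.add_re, Complex.re_ofReal_mul]
  ring

/-- Expand 0 ≤ K(τa − b) and divide by τ to bound the cross term. Equality holds for b = τa; this is
where the tempering coefficients come from. -/
theorem quadForm_sub_ge {K : Matrix ι ι ℂ} (hK : K.PosSemidef) {τ : ℝ} (hτ : 0 < τ)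
    (a b : ι → ℂ) :
    (1 - τ) * quadForm K a + (1 - 1 / τ) * quadForm K b ≤ quadForm K (a - b) := by
  have h1 := quadForm_smul_sub K 1 a b
  have h2 := quadForm_smul_sub K τ a b
  have h3 := quadForm_nonneg hK ((τ : ℂ) • a - b)
  rw [Complex.ofReal_one, one_smul] at h1
  rw [h2] at h3
  have h4 : 0 ≤ τ * quadForm K a - (star a ⬝ᵥ (K *ᵥ b) + star b ⬝ᵥ (K *ᵥ a)).re
      + 1 / τ * quadForm K b := by
    have := div_nonneg h3 hτ.le
    refine this.trans_eq ?_
    field_simp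
  rw [h1]
  linarith

theorem quadForm_comp_equiv {K : Matrix ι ι ℂ} (σ : ι ≃ ι) (hσ : ∀ a b, K (σ a) (σ b) = K a b)
    (v : ι → ℂ) : quadForm K (v ∘ σ) = quadForm K v := by
  simp only [quadForm, dotProduct, Matrix.mulVec, Function.comp_apply, Pi.star_apply]
  congr 1
  rw [← Equiv.sum_comp σ (fun a => star (v a) * ∑ b, K a b * v b)]
  refine Finset.sum_congr rfl fun a _ => ?_
  rw [← Equiv.sum_comp σ (fun b => K (σ a) b * v b)]
  simp only [hσ]

/-- A quadratic form invariant under a permutation of the coordinates dominates a quarter of its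
value on the skew part. -/
theorem quarter_quadForm_sub_comp_le {K : Matrix ι ι ℂ} (hK : K.PosSemidef) (σ : ι ≃ ι)
    (hσ : ∀ a b, K (σ a) (σ b) = K a b) (v : ι → ℂ) :
    1 / 4 * quadForm K (v - v ∘ σ) ≤ quadForm K v := by
  -- Parallelogram identity: K(v − v∘σ) + K(v + v∘σ) = 4K(v). The symmetric part, reached here with
  -- factor −1, is dropped.
  have h1 := quadForm_smul_sub K 1 v (v ∘ σ)
  have h2 := quadForm_smul_sub K (-1) v (v ∘ σ)
  have h3 := quadForm_nonneg hK (((-1 : ℝ) : ℂ) • v - v ∘ σ)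
  rw [quadForm_comp_equiv σ hσ] at h1 h2
  rw [Complex.ofReal_one, one_smul] at h1
  linarith

end QuadraticForm

/-! ### Trace inequalities for Hermitian matrices. -/

section Trace

variable {n : ℕ}

/-- With A = C*C, cyclicity turns the trace into that of CBC*. -/
theorem trace_mul_nonneg {A B : Matrix (Fin n) (Fin n) ℂ} (hA : A.PosSemidef)
    (hB : B.PosSemidef) : 0 ≤ (A * B).trace := by
  obtain ⟨C, rfl⟩ := CStarAlgebra.nonneg_iff_eq_star_mul_self.mp hA.nonneg
  rw [Matrix.star_eq_conjTranspose, Matrix.mul_assoc, Matrix.trace_mul_comm]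
  exact (hB.mul_mul_conjTranspose_same C).trace_nonneg

/-- Cauchy-Schwarz on the n diagonal entries; tr M² is the sum of all |Mᵢⱼ|², and the off-diagonal
ones are discarded. -/
theorem sq_trace_le {M : Matrix (Fin n) (Fin n) ℂ} (hM : M.IsHermitian) :
    M.trace.re ^ 2 ≤ n * (M * M).trace.re := by
  have h1 : (M * M).trace.re = ∑ i, ∑ j, ‖M i j‖ ^ 2 := by
    simp only [Matrix.trace, Matrix.diag_apply, Matrix.mul_apply, Complex.re_sum]
    refine Finset.sum_congr rfl fun i _ => Finset.sum_congr rfl fun j _ => ?_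
    rw [← hM.apply j i, Complex.star_def, Complex.mul_conj, Complex.normSq_eq_norm_sq,
      Complex.ofReal_re]
  have h2 : ∑ i, (M i i).re ^ 2 ≤ (M * M).trace.re := by
    rw [h1]
    refine Finset.sum_le_sum fun i _ => ?_
    refine le_trans ?_ (Finset.single_le_sum (f := fun j => ‖M i j‖ ^ 2) (fun j _ => by positivity)
      (Finset.mem_univ i))
    exact sq_le_sq.2 (by simpa using Complex.abs_re_le_norm (M i i))
  have h3 := sq_sum_le_card_mul_sum_sq (s := Finset.univ) (f := fun i => (M i i).re)
  simp only [Finset.card_univ, Fintype.card_fin] at h3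
  simp only [Matrix.trace, Matrix.diag_apply, Complex.re_sum] at h2 ⊢
  exact h3.trans (mul_le_mul_of_nonneg_left h2 (Nat.cast_nonneg n))

/-- AB need not be Hermitian, but for A = C*C it has the same power traces as the Hermitian matrix
CBC*. This is the source of the factor 1/n. -/
theorem sq_trace_mul_le {A B : Matrix (Fin n) (Fin n) ℂ} (hA : A.PosSemidef)
    (hB : B.IsHermitian) : (A * B).trace.re ^ 2 ≤ n * (A * B * A * B).trace.re := by
  obtain ⟨C, rfl⟩ := CStarAlgebra.nonneg_iff_eq_star_mul_self.mp hA.nonneg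
  rw [Matrix.star_eq_conjTranspose]
  have h := sq_trace_le (Matrix.isHermitian_mul_mul_conjTranspose C hB)
  have e1 : (Cᴴ * C * B).trace = (C * B * Cᴴ).trace := by
    rw [Matrix.mul_assoc, Matrix.trace_mul_comm]
  have e2 : (Cᴴ * C * B * (Cᴴ * C) * B).trace = (C * B * Cᴴ * (C * B * Cᴴ)).trace := by
    rw [← Matrix.mul_assoc (C * B * Cᴴ), Matrix.trace_mul_comm _ Cᴴ]
    simp only [Matrix.mul_assoc]
  rwa [e1, e2]

theorem trace_mul_im_eq_zero {A B : Matrix (Fin n) (Fin n) ℂ} (hA : A.IsHermitian)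
    (hB : B.IsHermitian) : (A * B).trace.im = 0 := by
  have h : star (A * B).trace = (A * B).trace := by
    rw [← Matrix.trace_conjTranspose, Matrix.conjTranspose_mul, hA.eq, hB.eq, Matrix.trace_mul_comm]
  exact Complex.conj_eq_iff_im.1 h

theorem sum_invMetric_mul (G M : Matrix (Fin n) (Fin n) ℂ) :
    ∑ k, ∑ l, invMetric G k l * M k l = (G⁻¹ * M).trace := by
  simp only [Matrix.trace, Matrix.diag_apply, Matrix.mul_apply, invMetric]
  exact Finset.sum_comm

/-- Makes g⁻¹ an admissible ξ in the curvature hypothesis on h. -/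
theorem posSemidef_invMetric {G : Matrix (Fin n) (Fin n) ℂ} (hG : G.PosDef) :
    (Matrix.of (invMetric G)).PosSemidef := hG.inv.posSemidef.transpose

end Trace

/-! ### Index contractions as values of one quadratic form on tensors S_{ik}^p. -/

section Contraction

variable {n : ℕ}

/-- The matrix of the Hermitian form `∑ g^{i j̄} g^{k l̄} h_{p q̄} S_{ik}^p conj(S_{jl}^q)`. -/
def contractionMatrix (G H : Matrix (Fin n) (Fin n) ℂ) :
    Matrix ((Fin n × Fin n) × Fin n) ((Fin n × Fin n) × Fin n) ℂ :=
  (G⁻¹ ⊗ₖ G⁻¹) ⊗ₖ Hᵀ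

theorem posSemidef_contractionMatrix {G H : Matrix (Fin n) (Fin n) ℂ} (hG : G.PosDef)
    (hH : H.PosDef) : (contractionMatrix G H).PosSemidef :=
  (hG.inv.posSemidef.kronecker hG.inv.posSemidef).kronecker hH.posSemidef.transpose

/-- A tensor `S_{ik}^p` as a vector. -/
def toVec (S : Fin n → Fin n → Fin n → ℂ) : (Fin n × Fin n) × Fin n → ℂ :=
  fun a => S a.1.1 a.1.2 a.2

theorem sum_reorder {M : Type*} [AddCommMonoid M] {ι : Type*} [Fintype ι]
    (f : ι → ι → ι → ι → ι → ι → M) :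
    ∑ j, ∑ l, ∑ q, ∑ i, ∑ k, ∑ p, f i j k l p q = ∑ i, ∑ j, ∑ k, ∑ l, ∑ p, ∑ q, f i j k l p q := by
  calc _ = ∑ j, ∑ l, ∑ i, ∑ q, ∑ k, ∑ p, f i j k l p q :=
        Finset.sum_congr rfl fun _ _ => Finset.sum_congr rfl fun _ _ => Finset.sum_comm
    _ = ∑ j, ∑ i, ∑ l, ∑ q, ∑ k, ∑ p, f i j k l p q :=
        Finset.sum_congr rfl fun _ _ => Finset.sum_comm
    _ = ∑ i, ∑ j, ∑ l, ∑ q, ∑ k, ∑ p, f i j k l p q := Finset.sum_comm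
    _ = ∑ i, ∑ j, ∑ l, ∑ k, ∑ q, ∑ p, f i j k l p q :=
        Finset.sum_congr rfl fun _ _ => Finset.sum_congr rfl fun _ _ =>
          Finset.sum_congr rfl fun _ _ => Finset.sum_comm
    _ = ∑ i, ∑ j, ∑ k, ∑ l, ∑ q, ∑ p, f i j k l p q :=
        Finset.sum_congr rfl fun _ _ => Finset.sum_congr rfl fun _ _ => Finset.sum_comm
    _ = _ :=
        Finset.sum_congr rfl fun _ _ => Finset.sum_congr rfl fun _ _ =>
          Finset.sum_congr rfl fun _ _ => Finset.sum_congr rfl fun _ _ => Finset.sum_comm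

/-- The conjugated indices j, l, q label the rows. The transpose built into `invMetric` absorbs this
for g⁻¹, whereas h needs the explicit `Hᵀ`. -/
theorem contraction_eq_sum (G H : Matrix (Fin n) (Fin n) ℂ) (S : Fin n → Fin n → Fin n → ℂ) :
    star (toVec S) ⬝ᵥ (contractionMatrix G H *ᵥ toVec S) =
      ∑ i, ∑ j, ∑ k, ∑ l, ∑ p, ∑ q, invMetric G i j * invMetric G k l * S i k p *
        conj (S j l q) * H p q := by
  rw [← sum_reorder]
  simp only [dotProduct, Matrix.mulVec, Fintype.sum_prod_type, contractionMatrix,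
    Matrix.kroneckerMap_apply, Matrix.transpose_apply, toVec, Pi.star_apply, invMetric,
    Finset.mul_sum, Complex.star_def]
  refine Finset.sum_congr rfl fun j _ => Finset.sum_congr rfl fun l _ =>
    Finset.sum_congr rfl fun q _ => Finset.sum_congr rfl fun i _ =>
    Finset.sum_congr rfl fun k _ => Finset.sum_congr rfl fun p _ => ?_
  ring

/-- Identifies the contracted square in the Chern-Lu identity with the contraction form, where the
torsion estimates live. -/
theorem sum_invMetric_trace (G H : Matrix (Fin n) (Fin n) ℂ)
    (S : Fin n → Matrix (Fin n) (Fin n) ℂ) :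
    ∑ i, ∑ j, invMetric G i j * (G⁻¹ * (S i * H * (S j)ᴴ)).trace =
      star (toVec fun i k p => S i k p) ⬝ᵥ
        (contractionMatrix G H *ᵥ toVec fun i k p => S i k p) := by
  rw [contraction_eq_sum]
  refine Finset.sum_congr rfl fun i _ => Finset.sum_congr rfl fun j _ => ?_
  rw [← sum_invMetric_mul]
  simp only [Finset.mul_sum]
  refine Finset.sum_congr rfl fun k _ => Finset.sum_congr rfl fun l _ => ?_
  simp only [Matrix.mul_apply, Matrix.conjTranspose_apply, Finset.mul_sum, Finset.sum_mul]
  rw [Finset.sum_comm]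
  refine Finset.sum_congr rfl fun p _ => Finset.sum_congr rfl fun q _ => ?_
  rw [Complex.star_def]
  ring

/-- Swapping the two lower indices of `S_{ik}^p`. -/
def swapLower (n : ℕ) : (Fin n × Fin n) × Fin n ≃ (Fin n × Fin n) × Fin n :=
  (Equiv.prodComm _ _).prodCongr (Equiv.refl _)

/-- Both lower indices are contracted with the same g⁻¹, so the form dominates a quarter of its
value on the skew part. -/
theorem contractionMatrix_swapLower (G H : Matrix (Fin n) (Fin n) ℂ)
    (a b : (Fin n × Fin n) × Fin n) :
    contractionMatrix G H (swapLower n a) (swapLower n b) = contractionMatrix G H a b := by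
  simp only [contractionMatrix, swapLower, Matrix.kroneckerMap_apply, Equiv.prodCongr_apply,
    Prod.map_fst, Prod.map_snd, Equiv.prodComm_apply, Prod.fst_swap, Prod.snd_swap]
  congr 1
  exact mul_comm _ _

variable {G H : (Fin n → ℂ) → Matrix (Fin n) (Fin n) ℂ} {z : Fin n → ℂ}

theorem toVec_torsion :
    toVec (torsion G z) = toVec (christoffel G z) - toVec (christoffel G z) ∘ swapLower n := rfl

/-- The square of the difference of two Chern connections controls their torsions. -/
theorem quadForm_connection_ge {K : Matrix (Fin n) (Fin n) ℂ} {L : Matrix (Fin n) (Fin n) ℂ}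
    (hK : K.PosDef) (hL : L.PosDef) {τ : ℝ} (hτ : 0 < τ) :
    (1 - τ) / 4 * quadForm (contractionMatrix K L) (toVec (torsion H z)) +
      (1 - 1 / τ) / 4 * quadForm (contractionMatrix K L) (toVec (torsion G z)) ≤
    quadForm (contractionMatrix K L) (toVec (christoffel H z) - toVec (christoffel G z)) := by
  have hP := posSemidef_contractionMatrix hK hL
  have h1 := quarter_quadForm_sub_comp_le hP (swapLower n) (contractionMatrix_swapLower K L)
    (toVec (christoffel H z) - toVec (christoffel G z))
  -- Torsion is the skew part of the connection, so skewing the difference of connections leaves the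
  -- difference of torsions.
  have e : toVec (christoffel H z) - toVec (christoffel G z) -
      (toVec (christoffel H z) - toVec (christoffel G z)) ∘ swapLower n =
      toVec (torsion H z) - toVec (torsion G z) := by
    rw [toVec_torsion, toVec_torsion]
    funext a
    simp only [Pi.sub_apply, Function.comp_apply]
    ring
  rw [e] at h1
  have h2 := quadForm_sub_ge hP hτ (toVec (torsion H z)) (toVec (torsion G z))
  linarith

/-- The two factors g in Q° cancel against the two inverse metrics, and h_{i j̄} takes their place.
The torsion part of Ric^τ paired with h is therefore the contraction form at T_g. -/
theorem trace_torsionSq {K : Matrix (Fin n) (Fin n) ℂ} (hG : IsUnit (G z)) :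
    ((G z)⁻¹ * torsionSq G z * (G z)⁻¹ * K).trace =
      star (toVec (torsion G z)) ⬝ᵥ (contractionMatrix (G z) K *ᵥ toVec (torsion G z)) := by
  have hdet := (Matrix.isUnit_iff_isUnit_det _).1 hG
  -- Q° as a combination of the matrices G E_{ji} G, so that the cancellation can be done on
  -- elementary matrices.
  have e : torsionSq G z = ∑ p, ∑ q, ∑ r, ∑ s, ∑ i, ∑ j,
      (invMetric (G z) p q * invMetric (G z) r s * torsion G z p r i * conj (torsion G z q s j)) •
        (G z * Matrix.single j i 1 * G z) := by
    ext k l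
    simp only [torsionSq, Matrix.of_apply, Matrix.sum_apply, Matrix.smul_apply, smul_eq_mul]
    refine Finset.sum_congr rfl fun p _ => Finset.sum_congr rfl fun q _ =>
      Finset.sum_congr rfl fun r _ => Finset.sum_congr rfl fun s _ =>
      Finset.sum_congr rfl fun i _ => Finset.sum_congr rfl fun j _ => ?_
    have : (G z * Matrix.single j i 1 * G z : Matrix (Fin n) (Fin n) ℂ) k l = G z k j * G z i l := by
      simp [Matrix.mul_apply, Matrix.single_apply, Finset.sum_ite_eq, ite_and]
    rw [this]
    ring
  have c : ∀ i j : Fin n, ((G z)⁻¹ * (G z * Matrix.single j i 1 * G z) * (G z)⁻¹ * K).trace =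
      K i j := fun i j => by
    have : (G z)⁻¹ * (G z * Matrix.single j i 1 * G z) * (G z)⁻¹ = Matrix.single j i 1 := by
      simp only [← Matrix.mul_assoc]
      rw [Matrix.nonsing_inv_mul _ hdet, Matrix.one_mul, Matrix.mul_assoc,
        Matrix.mul_nonsing_inv _ hdet, Matrix.mul_one]
    rw [this, Matrix.trace_single_mul]
    simp
  rw [e, contraction_eq_sum]
  simp only [Finset.mul_sum, Finset.sum_mul, Matrix.trace_sum, Matrix.mul_smul, Matrix.smul_mul,
    Matrix.trace_smul, c, smul_eq_mul]

theorem trace_ricciTwo {K : Matrix (Fin n) (Fin n) ℂ} :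
    ((G z)⁻¹ * ricciTwo G z * (G z)⁻¹ * K).trace =
      ∑ i, ∑ j, invMetric (G z) i j * ((G z)⁻¹ * curvatureMatrix G z i j * (G z)⁻¹ * K).trace := by
  have e : ricciTwo G z = ∑ i, ∑ j, invMetric (G z) i j • curvatureMatrix G z i j := by
    ext k l
    simp only [ricciTwo, curvatureMatrix, Matrix.of_apply, Matrix.sum_apply, Matrix.smul_apply,
      smul_eq_mul]
  rw [e]
  simp only [Finset.mul_sum, Finset.sum_mul, Matrix.trace_sum, Matrix.mul_smul, Matrix.smul_mul,
    Matrix.trace_smul, smul_eq_mul]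

/-- At ξ = g⁻¹ the numerator of RBC^τ splits into the curvature term of the Chern-Lu identity and
the contraction form at T_h. -/
theorem temperedRBC_invMetric_num (τ : ℝ) (K : Matrix (Fin n) (Fin n) ℂ) :
    ∑ α, ∑ β, ∑ γ, ∑ δ, (curvature H z α β γ δ - (((1 - τ) / 4 : ℝ) : ℂ) *
      ∑ ρ, ∑ σ, torsion H z α γ ρ * conj (torsion H z β δ σ) * H z ρ σ) *
        Matrix.of (invMetric K) α β * Matrix.of (invMetric K) γ δ =
    ∑ i, ∑ j, invMetric K i j * (K⁻¹ * curvatureMatrix H z i j).trace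
      - (((1 - τ) / 4 : ℝ) : ℂ) *
        (star (toVec (torsion H z)) ⬝ᵥ (contractionMatrix K (H z) *ᵥ toVec (torsion H z))) := by
  rw [contraction_eq_sum]
  simp only [Finset.mul_sum, ← Finset.sum_sub_distrib, ← sum_invMetric_mul]
  refine Finset.sum_congr rfl fun i _ => Finset.sum_congr rfl fun j _ => ?_
  refine Finset.sum_congr rfl fun k _ => Finset.sum_congr rfl fun l _ => ?_
  simp only [sub_mul, Finset.sum_mul, curvatureMatrix, Matrix.of_apply]
  congr 1
  · ring
  · refine Finset.sum_congr rfl fun p _ => Finset.sum_congr rfl fun q _ => ?_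
    ring

theorem tensorNormSq_invMetric {K L : Matrix (Fin n) (Fin n) ℂ} (hK : K.IsHermitian)
    (hL : L.IsHermitian) :
    tensorNormSq L (Matrix.of (invMetric K)) = (K⁻¹ * L * K⁻¹ * L).trace.re := by
  rw [tensorNormSq]
  congr 1
  have hK' : ∀ a b, conj (K⁻¹ a b) = K⁻¹ b a := fun a b => hK.inv.apply b a
  have hL' : ∀ a b, conj (L a b) = L b a := fun a b => hL.apply b a
  simp only [Matrix.of_apply, invMetric, hK', hL', Matrix.trace, Matrix.diag_apply,
    Matrix.mul_apply, Finset.sum_mul]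
  rw [Finset.sum_comm]
  refine Finset.sum_congr rfl fun β _ => ?_
  calc _ = ∑ γ, ∑ α, ∑ δ, L α γ * L δ β * K⁻¹ β α * K⁻¹ γ δ := Finset.sum_comm
    _ = ∑ γ, ∑ δ, ∑ α, L α γ * L δ β * K⁻¹ β α * K⁻¹ γ δ :=
        Finset.sum_congr rfl fun _ _ => Finset.sum_comm
    _ = ∑ δ, ∑ γ, ∑ α, L α γ * L δ β * K⁻¹ β α * K⁻¹ γ δ := Finset.sum_comm
    _ = _ := Finset.sum_congr rfl fun _ _ => Finset.sum_congr rfl fun _ _ =>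
        Finset.sum_congr rfl fun _ _ => by ring

end Contraction

/-! ### The differential inequality at a point. -/

section PointwiseInequality

variable {n : ℕ} {G H : (Fin n → ℂ) → Matrix (Fin n) (Fin n) ℂ} {z : Fin n → ℂ}

/-- The upper bound on `RBC^τ` of `h`, evaluated on the inverse metric of `g`. -/
theorem curvature_trace_le (hn : 1 ≤ n) {τ κ : ℝ} (hκ : 0 < κ) {K : Matrix (Fin n) (Fin n) ℂ}
    (hK : K.PosDef) (hH : (H z).PosDef)
    (hRBC : ∀ ξ : Matrix (Fin n) (Fin n) ℂ, ξ.PosSemidef → ξ ≠ 0 → temperedRBC τ H z ξ ≤ -κ) :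
    (∑ i, ∑ j, invMetric K i j * (K⁻¹ * curvatureMatrix H z i j).trace).re
      - (1 - τ) / 4 * quadForm (contractionMatrix K (H z)) (toVec (torsion H z)) ≤
    -(κ / n) * (K⁻¹ * H z).trace.re ^ 2 := by
  have : Nonempty (Fin n) := ⟨⟨0, hn⟩⟩
  have hn' : (0 : ℝ) < n := by exact_mod_cast hn
  have hne : Matrix.of (invMetric K) ≠ 0 := fun h0 => by
    have h1 : K⁻¹ = 0 := by
      ext a b
      exact congrFun (congrFun h0 b) a
    exact (hK.inv.trace_pos).ne' (by rw [h1, Matrix.trace_zero])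
  have h1 := hRBC _ (posSemidef_invMetric hK) hne
  have h2 := sq_trace_mul_le hK.inv.posSemidef hH.isHermitian
  -- The denominator |g⁻¹|²_h is positive: n times it dominates the square of tr(K⁻¹H) > 0.
  have hpos : 0 < (K⁻¹ * H z * K⁻¹ * H z).trace.re := by
    have h3 : 0 < (K⁻¹ * H z).trace := by
      obtain ⟨C, hC⟩ := CStarAlgebra.nonneg_iff_eq_star_mul_self.mp hK.inv.posSemidef.nonneg
      have hCu : IsUnit C := by
        have := hK.inv.isUnit
        rw [hC, Matrix.isUnit_iff_isUnit_det, Matrix.det_mul] at this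
        rw [Matrix.isUnit_iff_isUnit_det]
        exact isUnit_of_mul_isUnit_right this
      rw [hC, Matrix.star_eq_conjTranspose, Matrix.mul_assoc, Matrix.trace_mul_comm]
      exact ((Matrix.IsUnit.posDef_star_right_conjugate_iff hCu).2 hH).trace_pos
    have h4 := (Complex.lt_def.1 h3).1
    rw [Complex.zero_re] at h4
    have : 0 < (K⁻¹ * H z).trace.re ^ 2 := by positivity
    exact pos_of_mul_pos_right (this.trans_le h2) hn'.le
  rw [temperedRBC, temperedRBC_invMetric_num, tensorNormSq_invMetric hK.isHermitian hH.isHermitian,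
    div_le_iff₀ hpos, Complex.sub_re, Complex.re_ofReal_mul] at h1
  refine h1.trans ?_
  rw [neg_mul, neg_mul, neg_le_neg_iff, div_mul_eq_mul_div, div_le_iff₀ hn']
  nlinarith

/-- The parabolic Schwarz inequality at a point, in coordinates; `M` is the time derivative. -/
theorem schwarz_inequality_local (hn : 1 ≤ n) {τ κ : ℝ} (hτ : 0 < τ) (hκ : 0 < κ)
    (hG : EntryContDiff 2 G Set.univ z) (hH : EntryContDiff 2 H Set.univ z)
    (hGp : ∀ᶠ w in 𝓝 z, (G w).PosDef) (hHp : ∀ᶠ w in 𝓝 z, (H w).PosDef)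
    (hRBC : ∀ ξ : Matrix (Fin n) (Fin n) ℂ, ξ.PosSemidef → ξ ≠ 0 → temperedRBC τ H z ξ ≤ -κ)
    {M : Matrix (Fin n) (Fin n) ℂ} (hM : (M - (-temperedRicci τ G z - G z)).PosSemidef) :
    (-((G z)⁻¹ * M * (G z)⁻¹) * H z).trace.re -
      (∑ i, ∑ j, invMetric (G z) i j * dz i (dzbar j fun w => ((G w)⁻¹ * H w).trace) z).re ≤
    -(κ / n) * ((G z)⁻¹ * H z).trace.re ^ 2 + ((G z)⁻¹ * H z).trace.re := by
  have hGz := hGp.self_of_nhds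
  have hHz := hHp.self_of_nhds
  have hdet := (Matrix.isUnit_iff_isUnit_det _).1 hGz.isUnit
  have hcurv := curvature_trace_le hn hκ hGz hHz hRBC
  have hconn := quadForm_connection_ge (G := G) (H := H) (z := z) hGz hHz hτ
  have hpsi := sum_invMetric_trace (G z) (H z)
    (fun i => connectionMatrix H z i - connectionMatrix G z i)
  have hvec : (toVec fun i k p => (connectionMatrix H z i - connectionMatrix G z i) k p) =
      toVec (christoffel H z) - toVec (christoffel G z) := rfl
  rw [hvec] at hpsi
  -- The evolution inequality, with indices raised by g⁻¹ on both sides, is paired with h > 0.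
  have hT : 0 ≤ ((G z)⁻¹ * (M - (-temperedRicci τ G z - G z)) * (G z)⁻¹ * H z).trace.re := by
    have h1 := hM.conjTranspose_mul_mul_same (G z)⁻¹
    rw [hGz.isHermitian.inv.eq] at h1
    exact (Complex.le_def.1 (trace_mul_nonneg h1 hHz.posSemidef)).1
  have eT : ((G z)⁻¹ * (M - (-temperedRicci τ G z - G z)) * (G z)⁻¹ * H z).trace =
      ((G z)⁻¹ * M * (G z)⁻¹ * H z).trace + ((G z)⁻¹ * ricciTwo G z * (G z)⁻¹ * H z).trace +
      (((1 - 1 / τ) / 4 : ℝ) : ℂ) * ((G z)⁻¹ * torsionSq G z * (G z)⁻¹ * H z).trace +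
      ((G z)⁻¹ * H z).trace := by
    simp only [temperedRicci, mul_sub, sub_mul, mul_neg, neg_mul, mul_add, add_mul,
      Matrix.mul_smul, Matrix.smul_mul, Matrix.trace_add, Matrix.trace_sub, Matrix.trace_neg,
      Matrix.trace_smul, smul_eq_mul, Matrix.nonsing_inv_mul _ hdet, Matrix.one_mul]
    ring
  rw [eT, trace_torsionSq hGz.isUnit, trace_ricciTwo] at hT
  have eL : ∑ i, ∑ j, invMetric (G z) i j * dz i (dzbar j fun w => ((G w)⁻¹ * H w).trace) z =
      ∑ i, ∑ j, invMetric (G z) i j *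
          ((G z)⁻¹ * curvatureMatrix G z i j * (G z)⁻¹ * H z).trace
        - ∑ i, ∑ j, invMetric (G z) i j * ((G z)⁻¹ * curvatureMatrix H z i j).trace
        + ∑ i, ∑ j, invMetric (G z) i j * ((G z)⁻¹ * ((connectionMatrix H z i -
            connectionMatrix G z i) * H z *
            (connectionMatrix H z j - connectionMatrix G z j)ᴴ)).trace := by
    simp only [dz_dzbar_trace_inv_mul hG hH hGp hHp, mul_add, mul_sub, Finset.sum_add_distrib,
      Finset.sum_sub_distrib]
  rw [eL, hpsi, Matrix.neg_mul, Matrix.trace_neg]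
  simp only [Complex.add_re, Complex.sub_re, Complex.neg_re, Complex.re_ofReal_mul] at hT ⊢
  simp only [quadForm] at hcurv hconn
  -- The sum of `hT`, `hcurv` and `hconn`: the g-torsion cancels between the first and the last, the
  -- h-torsion between the last two.
  linarith

end PointwiseInequality

/-! ### Wirtinger derivatives depend only on germs. -/

section Congr

variable {n : ℕ} {z : Fin n → ℂ} {f f' : (Fin n → ℂ) → ℂ}

theorem dz_congr (h : f =ᶠ[𝓝 z] f') (i : Fin n) : dz i f z = dz i f' z := by
  rw [dz, dz, h.fderiv_eq]

theorem dzbar_congr (h : f =ᶠ[𝓝 z] f') (i : Fin n) : dzbar i f z = dzbar i f' z := by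
  rw [dzbar, dzbar, h.fderiv_eq]

end Congr

/-! ### Independence of the chart, and passage from coordinates to the manifold. -/

section Charts

variable {n : ℕ} {X : Type*} [TopologicalSpace X] [ChartedSpace (Fin n → ℂ) X]

/-- The matrix of the differential of `φ⁻¹` at `z`. -/
def chartFrame (φ : OpenPartialHomeomorph X (Fin n → ℂ)) (z : Fin n → ℂ) :
    Matrix (Fin n) (Fin n) ℂ :=
  Matrix.of fun k => (mfderiv 𝓘(ℂ, Fin n → ℂ) 𝓘(ℂ, Fin n → ℂ) φ.symm z
    (Pi.single k 1 : Fin n → ℂ) : Fin n → ℂ)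

/-- The matrix of a sesquilinear form in the model frame of the tangent space at `x`. -/
def modelMatrix (form : (x : X) → TangentSpace 𝓘(ℂ, Fin n → ℂ) x →ₗ[ℂ]
    TangentSpace 𝓘(ℂ, Fin n → ℂ) x →ₗ⋆[ℂ] ℂ) (x : X) : Matrix (Fin n) (Fin n) ℂ :=
  Matrix.of fun k l => form x (Pi.single k 1 : Fin n → ℂ) (Pi.single l 1 : Fin n → ℂ)

theorem sesquilinear_apply_eq_sum (B : (Fin n → ℂ) →ₗ[ℂ] (Fin n → ℂ) →ₗ⋆[ℂ] ℂ)
    (v w : Fin n → ℂ) :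
    B v w = ∑ a, ∑ b, v a * B (Pi.single a 1) (Pi.single b 1) * conj (w b) := by
  conv_lhs => rw [pi_eq_sum_univ' v, pi_eq_sum_univ' w]
  simp only [map_sum, LinearMap.sum_apply, map_smul, LinearMap.smul_apply, map_smulₛₗ, smul_eq_mul,
    Finset.mul_sum]
  rw [Finset.sum_comm]
  refine Finset.sum_congr rfl fun a _ => Finset.sum_congr rfl fun b _ => ?_
  ring

/-- A change of chart acts on components by congruence; all dependence on φ over a given point sits
in the frame matrix. -/
theorem components_eq (form : (x : X) → TangentSpace 𝓘(ℂ, Fin n → ℂ) x →ₗ[ℂ]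
    TangentSpace 𝓘(ℂ, Fin n → ℂ) x →ₗ⋆[ℂ] ℂ) (φ : OpenPartialHomeomorph X (Fin n → ℂ))
    (z : Fin n → ℂ) :
    components form φ z = chartFrame φ z * modelMatrix form (φ.symm z) * (chartFrame φ z)ᴴ := by
  ext k l
  refine (sesquilinear_apply_eq_sum (form (φ.symm z)) _ _).trans ?_
  simp only [Matrix.mul_apply, Matrix.conjTranspose_apply, Finset.sum_mul]
  rw [Finset.sum_comm]
  rfl

theorem posDef_modelMatrix (g : HermitianMetric n X) (x : X) : (modelMatrix g.form x).PosDef := by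
  have hherm : (modelMatrix g.form x).IsHermitian := by
    ext k l
    exact (g.hermitian x _ _).symm
  refine Matrix.PosDef.of_dotProduct_mulVec_pos hherm fun v hv => ?_
  let B : (Fin n → ℂ) →ₗ[ℂ] (Fin n → ℂ) →ₗ⋆[ℂ] ℂ := g.form x
  -- The matrix pairing conjugates its first vector, whereas the form is conjugate-linear in the
  -- second; hence `star v` in both slots.
  have e : star v ⬝ᵥ (modelMatrix g.form x *ᵥ v) = B (star v) (star v) := by
    rw [sesquilinear_apply_eq_sum B (star v) (star v)]
    simp only [dotProduct, Matrix.mulVec, Finset.mul_sum, modelMatrix, Matrix.of_apply,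
      Pi.star_apply, Complex.star_def, Complex.conj_conj, mul_assoc]
    rfl
  rw [e, Complex.lt_def]
  have hs : star v ≠ 0 := star_ne_zero.2 hv
  exact ⟨g.posDef x (star v : Fin n → ℂ) hs,
    (Complex.conj_eq_iff_im.1 (g.hermitian x (star v : Fin n → ℂ) (star v : Fin n → ℂ)).symm).symm⟩

theorem trace_eq_chartAt (g h : HermitianMetric n X) (x : X) :
    trace g h x = ((g.coeff (chartAt (Fin n → ℂ) x) (chartAt (Fin n → ℂ) x x))⁻¹ *
      h.coeff (chartAt (Fin n → ℂ) x) (chartAt (Fin n → ℂ) x x)).trace.re := by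
  rw [trace, sum_invMetric_mul]

/-- Lets statements about a single metric follow from those about families. -/
theorem smoothFamilyOn_const (g : HermitianMetric n X) :
    SmoothFamilyOn Set.univ (fun _ : ℝ => g) := fun φ hφ k l => by
  have h := (g.smooth φ hφ k l).comp (contDiffOn_snd (E := ℝ) (s := Set.univ ×ˢ φ.target))
    fun q hq => hq.2
  exact h

theorem HermitianMetric.entryContDiff (g : HermitianMetric n X)
    {φ : OpenPartialHomeomorph X (Fin n → ℂ)} (hφ : φ ∈ atlas (Fin n → ℂ) X) {z : Fin n → ℂ}
    (hz : z ∈ φ.target) : EntryContDiff 2 (g.coeff φ) Set.univ z := fun k l => by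
  rw [contDiffWithinAt_univ]
  exact ((g.smooth φ hφ k l).contDiffAt (φ.open_target.mem_nhds hz)).of_le ENat.LEInfty.out

variable [IsManifold 𝓘(ℂ, Fin n → ℂ) ω X]

/-- The inverse chart has injective differential. Its values on the basis are the rows of the frame,
so the transpose represents it. -/
theorem isUnit_chartFrame {φ : OpenPartialHomeomorph X (Fin n → ℂ)}
    (hφ : φ ∈ atlas (Fin n → ℂ) X) {z : Fin n → ℂ} (hz : z ∈ φ.target) :
    IsUnit (chartFrame φ z) := by
  have : IsManifold 𝓘(ℂ, Fin n → ℂ) 1 X := IsManifold.of_le (n := ω) le_top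
  have hinj := (mdifferentiable_of_mem_atlas (I := 𝓘(ℂ, Fin n → ℂ)) hφ).symm.mfderiv_injective
    (x := z) hz
  rw [← Matrix.isUnit_transpose, ← Matrix.mulVec_injective_iff_isUnit]
  let L : (Fin n → ℂ) →L[ℂ] (Fin n → ℂ) :=
    mfderiv 𝓘(ℂ, Fin n → ℂ) 𝓘(ℂ, Fin n → ℂ) φ.symm z
  have e : (chartFrame φ z)ᵀ.mulVec = L := by
    funext v
    conv_rhs => rw [pi_eq_sum_univ' v, map_sum]
    ext a
    simp only [Matrix.mulVec, dotProduct, Matrix.transpose_apply, map_smul, Finset.sum_apply,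
      Pi.smul_apply, smul_eq_mul]
    exact Finset.sum_congr rfl fun k _ => mul_comm _ _
  rw [e]
  exact hinj

theorem posDef_coeff (g : HermitianMetric n X) {φ : OpenPartialHomeomorph X (Fin n → ℂ)}
    (hφ : φ ∈ atlas (Fin n → ℂ) X) {z : Fin n → ℂ} (hz : z ∈ φ.target) :
    (g.coeff φ z).PosDef := by
  rw [HermitianMetric.coeff, components_eq]
  exact (Matrix.IsUnit.posDef_star_right_conjugate_iff (isUnit_chartFrame hφ hz)).2
    (posDef_modelMatrix g _)

/-- Under congruence G⁻¹H changes by a similarity, which the trace does not see. -/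
theorem trace_conj_inv_mul {P A B : Matrix (Fin n) (Fin n) ℂ} (hP : IsUnit P) :
    ((P * A * Pᴴ)⁻¹ * (P * B * Pᴴ)).trace = (A⁻¹ * B).trace := by
  have hd := (Matrix.isUnit_iff_isUnit_det _).1 hP
  have hd' := (Matrix.isUnit_iff_isUnit_det _).1 hP.star
  rw [Matrix.star_eq_conjTranspose] at hd'
  rw [Matrix.mul_inv_rev, Matrix.mul_inv_rev, Matrix.mul_assoc Pᴴ⁻¹, Matrix.trace_mul_comm]
  have : A⁻¹ * P⁻¹ * (P * B * Pᴴ) * Pᴴ⁻¹ = A⁻¹ * (P⁻¹ * P) * B * (Pᴴ * Pᴴ⁻¹) := by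
    simp only [Matrix.mul_assoc]
  rw [this, Matrix.nonsing_inv_mul _ hd, Matrix.mul_nonsing_inv _ hd', Matrix.mul_one,
    Matrix.mul_one]

/-- The trace `tr_g h` may be computed in any chart. -/
theorem trace_eq_of_mem_atlas (g h : HermitianMetric n X)
    {φ : OpenPartialHomeomorph X (Fin n → ℂ)} (hφ : φ ∈ atlas (Fin n → ℂ) X) {z : Fin n → ℂ}
    (hz : z ∈ φ.target) :
    (trace g h (φ.symm z) : ℂ) = ((g.coeff φ z)⁻¹ * h.coeff φ z).trace := by
  set x := φ.symm z with hx
  have hψ := chart_mem_atlas (Fin n → ℂ) x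
  have hzψ := mem_chart_target (Fin n → ℂ) x
  have key : ∀ {χ : OpenPartialHomeomorph X (Fin n → ℂ)} {w : Fin n → ℂ},
      χ ∈ atlas (Fin n → ℂ) X → w ∈ χ.target → χ.symm w = x →
      ((g.coeff χ w)⁻¹ * h.coeff χ w).trace =
        ((modelMatrix g.form x)⁻¹ * modelMatrix h.form x).trace := by
    intro χ w hχ hw hxw
    rw [HermitianMetric.coeff, HermitianMetric.coeff, components_eq, components_eq,
      trace_conj_inv_mul (isUnit_chartFrame hχ hw), hxw]
  rw [key hφ hz hx.symm]
  have h2 := key hψ hzψ ((chartAt (Fin n → ℂ) x).left_inv (mem_chart_source _ x))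
  rw [← h2]
  -- The definition of `trace` keeps only a real part; nothing is lost, since the trace of a product
  -- of two Hermitian matrices is real.
  apply Complex.ext
  · rw [Complex.ofReal_re, trace, sum_invMetric_mul]
  · rw [Complex.ofReal_im, trace_mul_im_eq_zero (posDef_coeff g hψ hzψ).inv.isHermitian
      (posDef_coeff h hψ hzψ).isHermitian]

theorem contDiffOn_trace {I : Set ℝ} {g : ℝ → HermitianMetric n X} (hg : SmoothFamilyOn I g)
    (h : HermitianMetric n X) {φ : OpenPartialHomeomorph X (Fin n → ℂ)}
    (hφ : φ ∈ atlas (Fin n → ℂ) X) :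
    ContDiffOn ℝ ∞ (fun p : ℝ × (Fin n → ℂ) => trace (g p.1) h (φ.symm p.2)) (I ×ˢ φ.target) := by
  intro p hp
  have hG : EntryContDiff ∞ (fun p : ℝ × (Fin n → ℂ) => (g p.1).coeff φ p.2) (I ×ˢ φ.target) p :=
    fun k l => hg φ hφ k l p hp
  have hH : EntryContDiff ∞ (fun p : ℝ × (Fin n → ℂ) => h.coeff φ p.2) (I ×ˢ φ.target) p :=
    fun k l => ((h.smooth φ hφ k l).comp contDiffOn_snd fun q hq => hq.2) p hp
  have hC := ((hG.inv (posDef_coeff (g p.1) hφ hp.2).isUnit).mul hH).trace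
  have hR := Complex.reCLM.contDiff.contDiffAt.comp_contDiffWithinAt p hC
  have e : ∀ q ∈ I ×ˢ φ.target, trace (g q.1) h (φ.symm q.2) =
      Complex.reCLM (((g q.1).coeff φ q.2)⁻¹ * h.coeff φ q.2).trace := fun q hq => by
    rw [← trace_eq_of_mem_atlas (g q.1) h hφ hq.2]
    simp
  exact hR.congr e (e p hp)

theorem uniqueDiffOn_of_ordConnected {I : Set ℝ} (hI : I.OrdConnected) (hI' : I.Nontrivial) :
    UniqueDiffOn ℝ I := by
  obtain ⟨a, ha, b, hb, hab⟩ := hI'.exists_lt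
  refine uniqueDiffOn_convex hI.convex ?_
  obtain ⟨c, hc⟩ := exists_between hab
  exact ⟨c, mem_interior.2 ⟨Set.Ioo a b, Set.Ioo_subset_Icc_self.trans (hI.out ha hb), isOpen_Ioo,
    hc⟩⟩

/-- The chart at x and the matrix of h do not move with time, so only the derivative of G⁻¹
contributes. -/
theorem derivWithin_trace {I : Set ℝ} (hI : UniqueDiffOn ℝ I) {g : ℝ → HermitianMetric n X}
    (hg : SmoothFamilyOn I g) (h : HermitianMetric n X) {t : ℝ} (ht : t ∈ I) (x : X) :
    derivWithin (fun s => trace (g s) h x) I t =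
      (-(((g t).coeff (chartAt (Fin n → ℂ) x) (chartAt (Fin n → ℂ) x x))⁻¹ * timeDeriv I g t x *
        ((g t).coeff (chartAt (Fin n → ℂ) x) (chartAt (Fin n → ℂ) x x))⁻¹) *
        h.coeff (chartAt (Fin n → ℂ) x) (chartAt (Fin n → ℂ) x x)).trace.re := by
  set φ := chartAt (Fin n → ℂ) x with hφd
  have hφ : φ ∈ atlas (Fin n → ℂ) X := chart_mem_atlas _ x
  have hz : φ x ∈ φ.target := mem_chart_target _ x
  have hG : EntryContDiff ∞ (fun s => (g s).coeff φ (φ x)) I t := fun k l =>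
    ((hg φ hφ k l).comp (contDiffOn_id.prodMk contDiffOn_const) fun s hs => ⟨hs, hz⟩) t ht
  have hH : EntryContDiff ∞ (fun _ : ℝ => h.coeff φ (φ x)) I t := fun k l =>
    contDiffWithinAt_const
  have hD := isDerivationWithin_derivWithin ht
  have hder := hD.trace_inv_mul hG hH (by simp)
    (Eventually.of_forall fun s => (posDef_coeff (g s) hφ hz).isUnit)
  rw [hD.entrywise_const, Matrix.mul_zero, add_zero] at hder
  have hdiff := (((hG.inv (posDef_coeff (g t) hφ hz).isUnit).mul hH).trace.differentiableWithinAt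
    (by simp)).hasDerivWithinAt
  have hre := (Complex.reCLM.hasFDerivAt.comp_hasDerivWithinAt t hdiff).derivWithin (hI t ht)
  have e : (fun s => trace (g s) h x) =
      Complex.reCLM ∘ fun s => (((g s).coeff φ (φ x))⁻¹ * h.coeff φ (φ x)).trace := by
    funext s
    exact trace_eq_chartAt (g s) h x
  rw [e, hre, hder]
  rfl

/-- `trace` uses a different preferred chart at each point. To differentiate, it is first rewritten
in the single chart at x on a whole neighbourhood. -/
theorem laplacian_trace (g h : HermitianMetric n X) (x : X) :
    laplacian g (trace g h) x =
      (∑ i, ∑ j, invMetric (g.coeff (chartAt (Fin n → ℂ) x) (chartAt (Fin n → ℂ) x x)) i j *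
        dz i (dzbar j fun w => ((g.coeff (chartAt (Fin n → ℂ) x) w)⁻¹ *
          h.coeff (chartAt (Fin n → ℂ) x) w).trace) (chartAt (Fin n → ℂ) x x)).re := by
  have hφ := chart_mem_atlas (Fin n → ℂ) x
  have hz := mem_chart_target (Fin n → ℂ) x
  have hev : ∀ᶠ w in 𝓝 (chartAt (Fin n → ℂ) x x), w ∈ (chartAt (Fin n → ℂ) x).target :=
    (chartAt (Fin n → ℂ) x).open_target.mem_nhds hz
  have key : ∀ i j, dz i (dzbar j fun w =>
      (trace g h ((chartAt (Fin n → ℂ) x).symm w) : ℂ)) (chartAt (Fin n → ℂ) x x) =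
      dz i (dzbar j fun w => ((g.coeff (chartAt (Fin n → ℂ) x) w)⁻¹ *
          h.coeff (chartAt (Fin n → ℂ) x) w).trace) (chartAt (Fin n → ℂ) x x) := fun i j =>
    dz_congr (hev.eventually_nhds.mono fun w hw => dzbar_congr
      (hw.mono fun w' hw' => trace_eq_of_mem_atlas g h hφ hw') j) i
  simp only [laplacian, key]

/-- The parabolic Schwarz inequality. -/
theorem schwarz_inequality (hn : 1 ≤ n) {I : Set ℝ} (hI : UniqueDiffOn ℝ I) {τ : ℝ} (hτ : 0 < τ)
    {g : ℝ → HermitianMetric n X} (hg : SmoothFamilyOn I g)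
    (hsuper : IsTemperedSupersolution τ I g) {h : HermitianMetric n X} {κ : ℝ} (hκ : 0 < κ)
    (hRBC : TemperedRBCLe τ h (-κ)) {t : ℝ} (ht : t ∈ I) (x : X) :
    derivWithin (fun s => trace (g s) h x) I t - laplacian (g t) (trace (g t) h) x ≤
      -(κ / n) * trace (g t) h x ^ 2 + trace (g t) h x := by
  have hφ := chart_mem_atlas (Fin n → ℂ) x
  have hz := mem_chart_target (Fin n → ℂ) x
  have hev := (chartAt (Fin n → ℂ) x).open_target.mem_nhds hz
  rw [derivWithin_trace hI hg h ht, laplacian_trace, trace_eq_chartAt]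
  exact schwarz_inequality_local hn hτ hκ ((g t).entryContDiff hφ hz) (h.entryContDiff hφ hz)
    (mem_of_superset hev fun w hw => posDef_coeff (g t) hφ hw)
    (mem_of_superset hev fun w hw => posDef_coeff h hφ hw) (hRBC x) (hsuper t ht x)

end Charts

/-! ### Second-order conditions at a maximum and the Levi form. -/

section SecondDerivative

variable {E : Type*} [NormedAddCommGroup E] [NormedSpace ℝ E]

/-- A positive second derivative would make a a local minimum as well, hence f locally constant, a
contradiction. -/
theorem deriv_deriv_nonpos_of_isLocalMax {f : ℝ → ℝ} {a : ℝ} (h : IsLocalMax f a)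
    (hc : ContinuousAt f a) : deriv (deriv f) a ≤ 0 := by
  by_contra! hpos
  have hmin := isLocalMin_of_deriv_deriv_pos hpos h.deriv_eq_zero hc
  have hconst : f =ᶠ[𝓝 a] fun _ => f a := by
    filter_upwards [h, hmin] with s h1 h2 using le_antisymm h1 h2
  have h1 := hconst.deriv.deriv_eq
  simp only [deriv_const'] at h1
  rw [h1] at hpos
  exact lt_irrefl _ hpos

theorem fderiv_fderiv_nonpos_of_isLocalMax {f : E → ℝ} {z : E} (hf : ContDiffAt ℝ 2 f z)
    (h : IsLocalMax f z) (v : E) : fderiv ℝ (fderiv ℝ f) z v v ≤ 0 := by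
  have hline : ∀ s : ℝ, HasDerivAt (fun s : ℝ => z + s • v) v s := fun s => by
    simpa using ((hasDerivAt_id s).smul_const v).const_add z
  have hcont : ContinuousAt (fun s : ℝ => z + s • v) 0 := (hline 0).continuousAt
  have h0 : z + (0 : ℝ) • v = z := by simp
  have htend : Tendsto (fun s : ℝ => z + s • v) (𝓝 0) (𝓝 z) := by
    simpa [ContinuousAt, h0] using hcont
  have hd1 : deriv (fun s : ℝ => f (z + s • v)) =ᶠ[𝓝 0] fun s => fderiv ℝ f (z + s • v) v := by
    filter_upwards [htend.eventually (hf.eventually (by simp))] with s hs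
    exact ((hs.differentiableAt two_ne_zero).hasFDerivAt.comp_hasDerivAt s (hline s)).deriv
  have hf' : DifferentiableAt ℝ (fderiv ℝ f) z :=
    (hf.fderiv_right (m := 1) (by norm_num)).differentiableAt one_ne_zero
  have hd2 : HasDerivAt (fun s : ℝ => fderiv ℝ f (z + s • v) v) (fderiv ℝ (fderiv ℝ f) z v v) 0 := by
    have h1 : HasFDerivAt (fderiv ℝ f) (fderiv ℝ (fderiv ℝ f) z) (z + (0 : ℝ) • v) := by
      rw [h0]; exact hf'.hasFDerivAt
    exact (ContinuousLinearMap.apply ℝ ℝ v).hasFDerivAt.comp_hasDerivAt (0 : ℝ)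
      (h1.comp_hasDerivAt (0 : ℝ) (hline 0))
  have hmax : IsLocalMax (fun s : ℝ => f (z + s • v)) 0 := by
    have := htend.eventually h
    simpa [IsLocalMax, IsMaxFilter, h0] using this
  have hfc : ContinuousAt (fun s : ℝ => f (z + s • v)) 0 := by
    refine ContinuousAt.comp (g := f) ?_ hcont
    rw [h0]
    exact hf.continuousAt
  have := deriv_deriv_nonpos_of_isLocalMax hmax hfc
  rwa [hd1.deriv_eq, hd2.deriv] at this

variable {n : ℕ}

theorem complex_smul_eq (c : ℂ) (u : Fin n → ℂ) : c • u = c.re • u + c.im • (Complex.I • u) := by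
  ext a
  simp only [Pi.smul_apply, Pi.add_apply, smul_eq_mul, Complex.real_smul]
  conv_lhs => rw [← Complex.re_add_im c]
  ring

theorem I_smul_complex_smul_eq (c : ℂ) (u : Fin n → ℂ) :
    Complex.I • c • u = c.re • (Complex.I • u) - c.im • u := by
  rw [complex_smul_eq c u]
  ext a
  simp only [Pi.smul_apply, Pi.add_apply, Pi.sub_apply, smul_eq_mul, Complex.real_smul]
  linear_combination (c.im : ℂ) * u a * Complex.I_sq

/-- The sesquilinear form `D(v, w) + D(iv, iw) + i (D(v, iw) - D(iv, w))` attached to a real bilinear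
form `D`. -/
def leviForm (D : (Fin n → ℂ) →L[ℝ] (Fin n → ℂ) →L[ℝ] ℝ) :
    (Fin n → ℂ) →ₗ[ℂ] (Fin n → ℂ) →ₗ⋆[ℂ] ℂ :=
  LinearMap.mk₂'ₛₗ (RingHom.id ℂ) (starRingEnd ℂ)
    (fun v w => ((D v w + D (Complex.I • v) (Complex.I • w) : ℝ) : ℂ) +
      Complex.I * ((D v (Complex.I • w) - D (Complex.I • v) w : ℝ) : ℂ))
    (fun v v' w => by
      simp only [smul_add, map_add, _root_.add_apply]; push_cast; ring)
    (fun c v w => by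
      rw [I_smul_complex_smul_eq, complex_smul_eq]
      simp only [map_add, map_sub, map_smul, _root_.add_apply, _root_.sub_apply,
        _root_.smul_apply, smul_eq_mul, RingHom.id_apply]
      apply Complex.ext <;> simp <;> ring)
    (fun v w w' => by
      simp only [smul_add, map_add]; push_cast; ring)
    (fun c v w => by
      rw [I_smul_complex_smul_eq, complex_smul_eq]
      simp only [map_add, map_sub, map_smul, smul_eq_mul]
      apply Complex.ext <;> simp <;> ring)

theorem leviForm_apply (D : (Fin n → ℂ) →L[ℝ] (Fin n → ℂ) →L[ℝ] ℝ) (v w : Fin n → ℂ) :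
    leviForm D v w = ((D v w + D (Complex.I • v) (Complex.I • w) : ℝ) : ℂ) +
      Complex.I * ((D v (Complex.I • w) - D (Complex.I • v) w : ℝ) : ℂ) := rfl

theorem fderiv_ofReal {f : E → ℝ} {z : E} (hf : DifferentiableAt ℝ f z) (v : E) :
    fderiv ℝ (fun w => (f w : ℂ)) z v = (fderiv ℝ f z v : ℂ) := by
  have := (Complex.ofRealCLM.hasFDerivAt.comp z hf.hasFDerivAt).fderiv
  exact congrArg (fun L => L v) this

/-- The factor 1/4 is the product of the two Wirtinger halves. -/
theorem dz_dzbar_ofReal {f : (Fin n → ℂ) → ℝ} {z : Fin n → ℂ} (hf : ContDiffAt ℝ 2 f z)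
    (i j : Fin n) :
    dz i (dzbar j fun w => (f w : ℂ)) z =
      (1 / 4 : ℂ) * leviForm (fderiv ℝ (fderiv ℝ f) z) (Pi.single i 1) (Pi.single j 1) := by
  have hf' : DifferentiableAt ℝ (fderiv ℝ f) z :=
    (hf.fderiv_right (m := 1) (by norm_num)).differentiableAt one_ne_zero
  have e1 : (dzbar j fun w => (f w : ℂ)) =ᶠ[𝓝 z] fun w => (1 / 2 : ℂ) *
      ((fderiv ℝ f w (Pi.single j 1) : ℂ) +
        Complex.I * (fderiv ℝ f w (Pi.single j Complex.I) : ℂ)) := by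
    filter_upwards [hf.eventually (by simp)] with w hw
    have hw' := hw.differentiableAt two_ne_zero
    rw [dzbar, fderiv_ofReal hw', fderiv_ofReal hw']
  have hv : ∀ v : Fin n → ℂ, HasFDerivAt (fun w => (fderiv ℝ f w v : ℂ))
      (Complex.ofRealCLM.comp ((fderiv ℝ (fderiv ℝ f) z).flip v)) z := fun v => by
    have h1 := hf'.hasFDerivAt.clm_apply (hasFDerivAt_const v z)
    simp only [ContinuousLinearMap.comp_zero, zero_add] at h1
    exact Complex.ofRealCLM.hasFDerivAt.comp z h1
  have hv' := (((hv (Pi.single j 1)).add ((hv (Pi.single j Complex.I)).const_mul Complex.I)).const_mul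
    (1 / 2 : ℂ)).fderiv
  have hI : ∀ a : Fin n, Complex.I • (Pi.single a 1 : Fin n → ℂ) = Pi.single a Complex.I := fun a => by
    rw [← Pi.single_smul, smul_eq_mul, mul_one]
  rw [dz_congr e1, dz, leviForm_apply, hI, hI]
  erw [hv']
  simp only [_root_.add_apply, _root_.smul_apply, ContinuousLinearMap.comp_apply,
    ContinuousLinearMap.flip_apply, Complex.ofRealCLM_apply, smul_eq_mul]
  push_cast
  linear_combination (-1 / 4 : ℂ) * (fderiv ℝ (fderiv ℝ f) z (Pi.single i Complex.I)
    (Pi.single j Complex.I) : ℂ) * Complex.I_sq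

/-- The complex Laplacian is non-positive at a local maximum. -/
theorem re_sum_dz_dzbar_nonpos_of_isLocalMax {f : (Fin n → ℂ) → ℝ} {z : Fin n → ℂ}
    (hf : ContDiffAt ℝ 2 f z) (h : IsLocalMax f z) {K : Matrix (Fin n) (Fin n) ℂ}
    (hK : K.PosDef) :
    (∑ i, ∑ j, invMetric K i j * dz i (dzbar j fun w => (f w : ℂ)) z).re ≤ 0 := by
  -- Factoring g⁻¹ = C*C writes the Laplacian as a sum of Levi forms at the conjugated rows of C.
  obtain ⟨C, hC⟩ := CStarAlgebra.nonneg_iff_eq_star_mul_self.mp (posSemidef_invMetric hK).nonneg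
  have hinv : ∀ i j, invMetric K i j = ∑ a, conj (C a i) * C a j := fun i j => by
    have := congrFun (congrFun hC i) j
    rwa [Matrix.of_apply, Matrix.star_eq_conjTranspose, Matrix.mul_apply] at this
  set Q := leviForm (fderiv ℝ (fderiv ℝ f) z) with hQ
  have e : ∑ i, ∑ j, invMetric K i j * dz i (dzbar j fun w => (f w : ℂ)) z =
      ∑ a, (1 / 4 : ℂ) * Q (fun i => conj (C a i)) (fun i => conj (C a i)) := by
    simp only [dz_dzbar_ofReal hf, hinv, Finset.sum_mul]
    calc _ = ∑ i, ∑ a, ∑ j, conj (C a i) * C a j *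
          ((1 / 4 : ℂ) * Q (Pi.single i 1) (Pi.single j 1)) :=
          Finset.sum_congr rfl fun _ _ => Finset.sum_comm
      _ = ∑ a, ∑ i, ∑ j, conj (C a i) * C a j *
          ((1 / 4 : ℂ) * Q (Pi.single i 1) (Pi.single j 1)) := Finset.sum_comm
      _ = _ := by
          refine Finset.sum_congr rfl fun a _ => ?_
          rw [sesquilinear_apply_eq_sum Q, Finset.mul_sum]
          refine Finset.sum_congr rfl fun i _ => ?_
          rw [Finset.mul_sum]
          refine Finset.sum_congr rfl fun j _ => ?_
          rw [Complex.conj_conj]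
          ring
  rw [e, Complex.re_sum]
  refine Finset.sum_nonpos fun a _ => ?_
  -- The real part of the Levi form at v is D(v, v) + D(iv, iv). The rest is imaginary, so symmetry
  -- of the Hessian is not required.
  have h1 := fderiv_fderiv_nonpos_of_isLocalMax hf h (fun i => conj (C a i))
  have h2 := fderiv_fderiv_nonpos_of_isLocalMax hf h (Complex.I • fun i => conj (C a i))
  rw [hQ, leviForm_apply]
  have e4 : (1 / 4 : ℂ) = ((1 / 4 : ℝ) : ℂ) := by push_cast; rfl
  rw [e4, Complex.re_ofReal_mul, Complex.add_re, Complex.ofReal_re, Complex.I_mul_re,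
    Complex.ofReal_im]
  linarith

end SecondDerivative

/-! ### The parabolic maximum principle on a compact manifold. -/

section MaximumPrinciple

variable {n : ℕ} {X : Type*} [TopologicalSpace X] [ChartedSpace (Fin n → ℂ) X]
  [IsManifold 𝓘(ℂ, Fin n → ℂ) ω X]

theorem contDiffOn_trace_chart (g h : HermitianMetric n X)
    {φ : OpenPartialHomeomorph X (Fin n → ℂ)} (hφ : φ ∈ atlas (Fin n → ℂ) X) :
    ContDiffOn ℝ ∞ (fun z => trace g h (φ.symm z)) φ.target := by
  have h1 : ContDiffOn ℝ ∞ (fun p : ℝ × (Fin n → ℂ) => trace g h (φ.symm p.2))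
      (Set.univ ×ˢ φ.target) := contDiffOn_trace (g := fun _ => g) (smoothFamilyOn_const g) h hφ
  have h2 : ContDiffOn ℝ ∞ (fun z : Fin n → ℂ => ((0 : ℝ), z)) φ.target :=
    contDiffOn_const.prodMk contDiffOn_id
  have h3 := h1.comp h2 fun z hz => ⟨Set.mem_univ _, hz⟩
  simpa only [Function.comp_def] using h3

theorem laplacian_trace_nonpos_of_isMax (g h : HermitianMetric n X) {x : X}
    (hx : ∀ y, trace g h y ≤ trace g h x) : laplacian g (trace g h) x ≤ 0 := by
  have hφ := chart_mem_atlas (Fin n → ℂ) x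
  have hz := mem_chart_target (Fin n → ℂ) x
  refine re_sum_dz_dzbar_nonpos_of_isLocalMax (((contDiffOn_trace_chart g h hφ).contDiffAt
    ((chartAt (Fin n → ℂ) x).open_target.mem_nhds hz)).of_le ENat.LEInfty.out) ?_
    (posDef_coeff g hφ hz)
  refine Eventually.of_forall fun w => ?_
  simp only [(chartAt (Fin n → ℂ) x).left_inv (mem_chart_source _ x)]
  exact hx _

theorem continuousOn_trace {I : Set ℝ} {g : ℝ → HermitianMetric n X} (hg : SmoothFamilyOn I g)
    (h : HermitianMetric n X) :
    ContinuousOn (fun p : ℝ × X => trace (g p.1) h p.2) (I ×ˢ Set.univ) := by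
  rintro ⟨t, x⟩ ⟨ht, -⟩
  set φ := chartAt (Fin n → ℂ) x with hφd
  have hφ : φ ∈ atlas (Fin n → ℂ) X := chart_mem_atlas _ x
  have hxs : x ∈ φ.source := mem_chart_source _ x
  have hmaps : Set.MapsTo (fun p : ℝ × X => (p.1, φ p.2)) (I ×ˢ φ.source) (I ×ˢ φ.target) :=
    fun p hp => ⟨hp.1, φ.map_source hp.2⟩
  have hc : ContinuousOn (fun p : ℝ × X => (p.1, φ p.2)) (I ×ˢ φ.source) :=
    continuousOn_fst.prodMk (φ.continuousOn.comp continuousOn_snd fun p hp => hp.2)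
  have h1 := (contDiffOn_trace hg h hφ).continuousOn.comp hc hmaps
  have h2 : ContinuousOn (fun p : ℝ × X => trace (g p.1) h p.2) (I ×ˢ φ.source) :=
    h1.congr fun p hp => by simp only [Function.comp_apply, φ.left_inv hp.2]
  refine (h2 (t, x) ⟨ht, hxs⟩).mono_of_mem_nhdsWithin ?_
  rw [nhdsWithin_prod_eq, nhdsWithin_univ]
  exact prod_mem_prod self_mem_nhdsWithin (φ.open_source.mem_nhds hxs)

theorem continuous_trace (g h : HermitianMetric n X) : Continuous (trace g h) := by
  have h1 : ContinuousOn (fun p : ℝ × X => trace g h p.2) (Set.univ ×ˢ Set.univ) :=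
    continuousOn_trace (g := fun _ => g) (smoothFamilyOn_const g) h
  rw [Set.univ_prod_univ, continuousOn_univ] at h1
  have h2 : Continuous fun x : X => ((0 : ℝ), x) := by fun_prop
  have h3 := h1.comp h2
  simpa only [Function.comp_def] using h3

/-- One-sided Fermat: s − t points from t into [s, t], and the derivative along it is non-positive.
Looking only backwards in time covers interior points and a right end point alike. -/
theorem derivWithin_nonneg_of_le_of_mem {I : Set ℝ} (hI : I.OrdConnected) {f : ℝ → ℝ} {s t : ℝ}
    (hs : s ∈ I) (ht : t ∈ I) (hst : s < t) (hf : ∀ r ∈ Set.Icc s t, f r ≤ f t) :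
    0 ≤ derivWithin f I t := by
  by_cases hd : DifferentiableWithinAt ℝ f I t
  · have h1 := (hd.hasDerivWithinAt.mono (hI.out hs ht)).hasFDerivWithinAt
    have hmax : IsLocalMaxOn f (Set.Icc s t) t :=
      eventually_of_mem self_mem_nhdsWithin fun r hr => hf r hr
    have h2 := hmax.hasFDerivWithinAt_nonpos h1 (y := s - t)
      (sub_mem_posTangentConeAt_of_segment_subset (by
        rw [segment_symm, segment_eq_Icc hst.le]))
    simp only [ContinuousLinearMap.toSpanSingleton_apply, smul_eq_mul] at h2
    nlinarith
  -- Here `derivWithin` takes its default value 0.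
  · rw [derivWithin_zero_of_not_differentiableWithinAt hd]

/-- The maximum principle for the parabolic Schwarz inequality. -/
theorem trace_le_max [CompactSpace X] {I : Set ℝ} (hI : I.OrdConnected)
    {g : ℝ → HermitianMetric n X} (hg : SmoothFamilyOn I g) (h : HermitianMetric n X) {c : ℝ}
    (hineq : ∀ t ∈ I, ∀ x, c < trace (g t) h x →
      derivWithin (fun s => trace (g s) h x) I t - laplacian (g t) (trace (g t) h) x < 0)
    (h0 : (0 : ℝ) ∈ I) {b : ℝ} (hb : ∀ x, trace (g 0) h x ≤ b) {t : ℝ} (ht : t ∈ I) (ht0 : 0 ≤ t)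
    (x : X) : trace (g t) h x ≤ max b c := by
  by_contra! hlt
  have hcont : ContinuousOn (fun p : ℝ × X => trace (g p.1) h p.2) (Set.Icc 0 t ×ˢ Set.univ) :=
    (continuousOn_trace hg h).mono (Set.prod_mono (hI.out h0 ht) subset_rfl)
  obtain ⟨⟨t₀, x₀⟩, ⟨ht₀, -⟩, hmax⟩ := (isCompact_Icc.prod isCompact_univ).exists_isMaxOn
    ⟨(t, x), ⟨Set.right_mem_Icc.2 ht0, Set.mem_univ _⟩⟩ hcont
  have hle : ∀ s ∈ Set.Icc 0 t, ∀ y, trace (g s) h y ≤ trace (g t₀) h x₀ := fun s hs y =>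
    isMaxOn_iff.1 hmax (s, y) ⟨hs, Set.mem_univ _⟩
  have hbig := hlt.trans_le (hle t (Set.right_mem_Icc.2 ht0) x)
  -- At time 0 the values are at most b, below the supposed maximum.
  have ht₀pos : 0 < t₀ := by
    refine lt_of_le_of_ne ht₀.1 fun heq => ?_
    subst heq
    exact absurd (hb x₀) (not_le.2 ((le_max_left b c).trans_lt hbig))
  have ht₀I := hI.out h0 ht ht₀
  have h1 := derivWithin_nonneg_of_le_of_mem hI (f := fun s => trace (g s) h x₀) h0 ht₀I ht₀pos
    fun r hr => hle r ⟨hr.1, hr.2.trans ht₀.2⟩ x₀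
  have h2 := laplacian_trace_nonpos_of_isMax (g t₀) h (hle t₀ ht₀)
  have h3 := hineq t₀ ht₀I x₀ ((le_max_right b c).trans_lt hbig)
  linarith

end MaximumPrinciple

end TemperedSchwarz

end

/-! ### The theorem. -/

theorem theorem4p1 {n : ℕ} (hn : 1 ≤ n) {X : Type*} [TopologicalSpace X]
    [ChartedSpace (Fin n → ℂ) X] [IsManifold 𝓘(ℂ, Fin n → ℂ) ω X]
    (I : Set ℝ) (hI : I.OrdConnected) (hI' : I.Nontrivial)
    (τ : ℝ) (hτ : 0 < τ)
    (g : ℝ → TemperedSchwarz.HermitianMetric n X)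
    (hg : TemperedSchwarz.SmoothFamilyOn I g)
    (hsuper : TemperedSchwarz.IsTemperedSupersolution τ I g)
    (h : TemperedSchwarz.HermitianMetric n X)
    (κ₀ : ℝ) (hκ₀ : 0 < κ₀)
    (hRBC : TemperedSchwarz.TemperedRBCLe τ h (-κ₀)) :
    (∀ φ ∈ atlas (Fin n → ℂ) X,
      ContDiffOn ℝ ∞ (fun p : ℝ × (Fin n → ℂ) =>
        TemperedSchwarz.trace (g p.1) h (φ.symm p.2)) (I ×ˢ φ.target)) ∧
    (∀ t ∈ I, ∀ x : X,
      derivWithin (fun s => TemperedSchwarz.trace (g s) h x) I t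
          - TemperedSchwarz.laplacian (g t) (TemperedSchwarz.trace (g t) h) x
        ≤ -(κ₀ / n) * TemperedSchwarz.trace (g t) h x ^ 2
          + TemperedSchwarz.trace (g t) h x) ∧
    (CompactSpace X → 0 ∈ I →
      BddAbove (Set.range (TemperedSchwarz.trace (g 0) h)) ∧
      ∀ t ∈ I, 0 ≤ t → ∀ x : X,
        TemperedSchwarz.trace (g t) h x
          ≤ max (⨆ y : X, TemperedSchwarz.trace (g 0) h y) (n / κ₀)) := by
  have hI₁ := TemperedSchwarz.uniqueDiffOn_of_ordConnected hI hI'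
  have hmain := fun t (ht : t ∈ I) (x : X) =>
    TemperedSchwarz.schwarz_inequality hn hI₁ hτ hg hsuper hκ₀ hRBC ht x
  refine ⟨fun φ hφ => TemperedSchwarz.contDiffOn_trace hg h hφ, hmain, fun _ h0 => ?_⟩
  have hbdd := (isCompact_range (TemperedSchwarz.continuous_trace (g 0) h)).bddAbove
  refine ⟨hbdd, fun t ht ht0 x => TemperedSchwarz.trace_le_max hI hg h
    (fun s hs y hy => (hmain s hs y).trans_lt ?_) h0 (fun y => le_ciSup hbdd y) ht ht0 x⟩
  have hn' : (0 : ℝ) < n := by exact_mod_cast hn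
  have hc : 0 < (n : ℝ) / κ₀ := by positivity
  -- n/κ₀ is the positive zero of −κ₀u²/n + u; beyond it the right-hand side is strictly negative.
  have h1 : 1 < κ₀ / n * TemperedSchwarz.trace (g s) h y := by
    have := mul_lt_mul_of_pos_left hy (show 0 < κ₀ / n by positivity)
    rwa [div_mul_div_cancel₀ hn'.ne', div_self hκ₀.ne'] at this
  nlinarith [hc.trans hy]
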